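/- Let $\mathbb{F}$ be a field of characteristic $0$ and let $K$ be a finite group. \emph{The shifted Burnside functor and its ideals.} For a finite group $G$, let $\mathbb{F}B(G)=\mathbb{F}\otimes_{\mathbb{Z}}B(G)$, where $B(G)$ is the Grothendieck group of finite $G$-sets (for disjoint union), and let $\mathbb{F}B_K(G)=\mathbb{F}B(G\times K)$. A finite $(H,G)$-biset $U$ induces the linear map $\mathbb{F}B_K(U):\mathbb{F}B_K(G)\to\mathbb{F}B_K(H)$, $[X]\mapsto[(U\times K)\times_{G\times K}X]$, where $K$ acts on both sides of $U\times K$ by multiplication on the second component. There are bilinear products $\mathbb{F}B_K(G)\times\mathbb{F}B_K(H)\to\mathbb{F}B_K(G\times H)$, $([X],[Y])\mapsto[X\times Y]$, where $(g,h,k)\in G\times H\times K$ acts on $X\times Y$ by $(g,h,k)(x,y)=((g,k)x,(h,k)y)$. These make $\mathbb{F}B_K$ a commutative Green biset functor. An ideal $I$ of $\mathbb{F}B_K$ is a family of subspaces $I(G)\subseteq\mathbb{F}B_K(G)$, for all finite groups $G$, such that $\mathbb{F}B_K(U)(I(G))\subseteq I(H)$ for every finite $(H,G)$-biset $U$, and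 such that the product maps $\mathbb{F}B_K(G)\times I(H)$ into $I(G\times H)$ for all finite groups $G,H$. Let $\mathcal{I}_{\mathbb{F}B_K}$ be the complete lattice of ideals of $\mathbb{F}B_K$, ordered by inclusion; its joins are sums and its meets are intersections. \emph{Groups over $K$.} A group over $K$ is a pair $(L,\varphi)$, where $L$ is a finite group and $\varphi:L\to K$ is a group homomorphism. A morphism $(L,\varphi)\to(L',\varphi')$ is a group homomorphism $f:L\to L'$ such that $i\circ\varphi=\varphi'\circ f$ for some inner automorphism $i$ of $K$. We write $(L,\varphi)\twoheadrightarrow(L',\varphi')$ if there is such a morphism $f$ which is surjective. Let $\mathsf{e}_{L,\varphi}$ be the ideal of $\mathbb{F}B_K$ generated by the idempotent $e_{L_\varphi}^{L\times K}\in\mathbb{F}B_K(L)$, where $L_\varphi=\{(l,\varphi(l))\mid l\in L\}$ and where, for a subgroup $Y$ of a finite group $G$, $$e_Y^{G}=\frac{1}{|N_G(Y)|}\sum_{X\leq Y}|X|\,\mu(X,Y)\,[G/X]\in\mathbb{F}B(G),$$ $\mu$ being the Möbius function of the poset of subgroups of $G$. \emph{$B_K$-groups.} For a normal subgroup $N$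 of a finite group $L$, let $$m_{L,N}=\frac{1}{|L|}\sum_{X\leq L,\;XN=L}|X|\,\mu(X,L).$$ A group $(L,\varphi)$ over $K$ is a $B_K$-group if $m_{L,N}=0$ for every non-trivial normal subgroup $N$ of $L$ contained in $\operatorname{Ker}\varphi$. Fix a set $\mathcal{S}_K$ of representatives of the isomorphism classes of groups over $K$, and let $\mathcal{B}_K$ be the subset of $\mathcal{S}_K$ consisting of $B_K$-groups. A subset $\mathcal{P}$ of $\mathcal{B}_K$ is closed if $(M,\psi)\in\mathcal{P}$ whenever $(M,\psi)\in\mathcal{B}_K$ and $(M,\psi)\twoheadrightarrow(L,\varphi)$ for some $(L,\varphi)\in\mathcal{P}$. Let $\mathcal{C}l_{\mathcal{B}_K}$ be the lattice of closed subsets of $\mathcal{B}_K$, ordered by inclusion. \textbf{Theorem.} The map $$I\mapsto\mathcal{P}_I=\{(L,\varphi)\in\mathcal{B}_K\mid\mathsf{e}_{L,\varphi}\subseteq I\}$$ is an isomorphism of lattices from $\mathcal{I}_{\mathbb{F}B_K}$ to $\mathcal{C}l_{\mathcal{B}_K}$. The inverse isomorphism is the map $$\mathcal{P}\mapsto I_{\mathcal{P}}=\sum_{(L,\varphi)\in\mathcal{P}}\mathsf{e}_{L,\varphi}.$$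 In particular the lattice $\mathcal{I}_{\mathbb{F}B_K}$ is completely distributive: arbitrary meets distribute over arbitrary joins, and arbitrary joins distribute over arbitrary meets. -/

import Mathlib

open CategoryTheory MulOpposite

universe u v w₁ w₂

namespace RelativeBGroups

/-! ## The Burnside functor -/

/-- A finite left `G`-set. -/
structure FinGSet (G : Type u) [Group G] : Type (u + 1) where
  carrier : Type u
  [finite : Finite carrier]
  [action : MulAction G carrier]

attribute [instance] FinGSet.finite FinGSet.action

namespace FinGSet

variable {G H : Type u} [Group G] [Group H]

/-- Isomorphism of `G`-sets: a `G`-equivariant bijection. -/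
def IsIso (X Y : FinGSet G) : Prop :=
  ∃ e : X.carrier ≃ Y.carrier, ∀ (g : G) (x : X.carrier), e (g • x) = g • e x

/-- Disjoint union of `G`-sets. -/
def sum (X Y : FinGSet G) : FinGSet G where
  carrier := X.carrier ⊕ Y.carrier

/-- The `(G × H)`-set `X × Y`, for a `G`-set `X` and an `H`-set `Y`. -/
def prod (X : FinGSet G) (Y : FinGSet H) : FinGSet (G × H) where
  carrier := X.carrier × Y.carrier
  action :=
    { smul := fun g p => (g.1 • p.1, g.2 • p.2)
      one_smul := fun p => Prod.ext (one_smul G p.1) (one_smul H p.2)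
      mul_smul := fun g h p => Prod.ext (mul_smul g.1 h.1 p.1) (mul_smul g.2 h.2 p.2) }

/-- Restriction of the action along a group homomorphism `f : H → G`. -/
def res (f : H →* G) (X : FinGSet G) : FinGSet H where
  carrier := X.carrier
  action := MulAction.compHom X.carrier f

/-- The transitive `G`-set `G / X`. -/
def transitive [Finite G] (X : Subgroup G) : FinGSet G where
  carrier := G ⧸ X

end FinGSet

/-- The relations `[X] = [Y]` for `X ≅ Y`, and `[X ⊔ Y] = [X] + [Y]`. -/
noncomputable def burnsideRelations (F : Type v) [Field F] (G : Type u) [Group G] :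
    Submodule F (FinGSet G →₀ F) :=
  Submodule.span F
    ({r | ∃ X Y : FinGSet G, X.IsIso Y ∧
        r = Finsupp.single X (1 : F) - Finsupp.single Y (1 : F)} ∪
     {r | ∃ X Y : FinGSet G,
        r = Finsupp.single (X.sum Y) (1 : F)
          - (Finsupp.single X (1 : F) + Finsupp.single Y (1 : F))})

/-- `𝔽B(G) = 𝔽 ⊗ B(G)`, where `B(G)` is the Grothendieck group of finite `G`-sets for
disjoint union: the vector space generated by the finite `G`-sets, subject to the defining
relations of the Grothendieck group. -/
abbrev Burnside (F : Type v) [Field F] (G : Type u) [Group G] : Type (max (u + 1) v) :=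
  (FinGSet G →₀ F) ⧸ burnsideRelations F G

namespace Burnside

variable {F : Type v} [Field F] {G H : Type u} [Group G] [Group H]

/-- The class `[X]` of a finite `G`-set. -/
noncomputable def cls (F : Type v) [Field F] {G : Type u} [Group G] (X : FinGSet G) :
    Burnside F G :=
  (burnsideRelations F G).mkQ (Finsupp.single X 1)

theorem cls_eq_of_iso {X Y : FinGSet G} (h : X.IsIso Y) : cls F X = cls F Y := by
  rw [← sub_eq_zero, cls, cls, ← map_sub, Submodule.mkQ_apply, Submodule.Quotient.mk_eq_zero]
  exact Submodule.subset_span (Or.inl ⟨X, Y, h, rfl⟩)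

theorem cls_sum (X Y : FinGSet G) : cls F (X.sum Y) = cls F X + cls F Y := by
  rw [← sub_eq_zero, cls, cls, cls, ← map_add, ← map_sub, Submodule.mkQ_apply,
    Submodule.Quotient.mk_eq_zero]
  exact Submodule.subset_span (Or.inr ⟨X, Y, rfl⟩)

/-- The linear extension of an isomorphism-invariant additive function on finite `G`-sets. -/
noncomputable def lift {M : Type*} [AddCommGroup M] [Module F M] (f : FinGSet G → M)
    (hiso : ∀ X Y : FinGSet G, X.IsIso Y → f X = f Y)
    (hsum : ∀ X Y : FinGSet G, f (X.sum Y) = f X + f Y) : Burnside F G →ₗ[F] M :=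
  (burnsideRelations F G).liftQ (Finsupp.linearCombination F f) (by
    rw [burnsideRelations, Submodule.span_le]
    rintro r (⟨X, Y, h, rfl⟩ | ⟨X, Y, rfl⟩)
    · simp [hiso X Y h]
    · simp [hsum X Y])

theorem lift_cls {M : Type*} [AddCommGroup M] [Module F M] (f : FinGSet G → M)
    (hiso : ∀ X Y : FinGSet G, X.IsIso Y → f X = f Y)
    (hsum : ∀ X Y : FinGSet G, f (X.sum Y) = f X + f Y) (X : FinGSet G) :
    lift (F := F) f hiso hsum (cls F X) = f X := by
  simp [lift, cls]

theorem hom_ext {M : Type*} [AddCommGroup M] [Module F M] {f g : Burnside F G →ₗ[F] M}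
    (h : ∀ X, f (cls F X) = g (cls F X)) : f = g := by
  apply Submodule.linearMap_qext
  apply Finsupp.lhom_ext'
  intro X
  apply LinearMap.ext_ring
  exact h X

end Burnside

/-! ## Bisets -/

/-- A finite `(H, G)`-biset: commuting left `H`-action and right `G`-action. The right action is
written `op g • x` for `x · g`. -/
structure FinBiset (H G : Type u) [Group H] [Group G] : Type (u + 1) where
  carrier : Type u
  [finite : Finite carrier]
  [left : MulAction H carrier]
  [right : MulAction Gᵐᵒᵖ carrier]
  [comm : SMulCommClass H Gᵐᵒᵖ carrier]

attribute [instance] FinBiset.finite FinBiset.left FinBiset.right FinBiset.comm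

namespace FinBiset

variable {H G : Type u} [Group H] [Group G]

/-- The equivalence relation on `U × X` given by the orbits of the action
`(u, x) · g = (u g, g⁻¹ x)` of `G`. -/
def tensorSetoid (U : FinBiset H G) (X : FinGSet G) : Setoid (U.carrier × X.carrier) where
  r p q := ∃ g : G, q = (op g • p.1, g⁻¹ • p.2)
  iseqv :=
    { refl := fun p => ⟨1, by simp⟩
      symm := by
        rintro p _ ⟨g, rfl⟩
        exact ⟨g⁻¹, by simp⟩
      trans := by
        rintro p _ _ ⟨g, rfl⟩ ⟨h, rfl⟩
        exact ⟨g * h, by simp [mul_smul]⟩ }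

/-- The `H`-set `U ×_G X = (U × X) / G`. -/
def tensor (U : FinBiset H G) (X : FinGSet G) : FinGSet H where
  carrier := Quotient (U.tensorSetoid X)
  action :=
    { smul := fun h => Quotient.map (fun p => (h • p.1, p.2)) (by
        rintro p _ ⟨g, rfl⟩
        exact ⟨g, by simp [smul_comm]⟩)
      one_smul := by
        rintro ⟨p⟩
        exact congrArg (Quotient.mk _) (Prod.ext (one_smul H p.1) rfl)
      mul_smul := by
        rintro h k ⟨p⟩
        exact congrArg (Quotient.mk _) (Prod.ext (mul_smul h k p.1) rfl) }

theorem tensor_iso (U : FinBiset H G) {X Y : FinGSet G} (h : X.IsIso Y) :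
    (U.tensor X).IsIso (U.tensor Y) := by
  obtain ⟨e, he⟩ := h
  refine ⟨Quotient.congr (Equiv.prodCongr (Equiv.refl _) e) ?_, ?_⟩
  · rintro ⟨u, x⟩ ⟨u', x'⟩
    constructor
    · rintro ⟨g, hg⟩
      obtain ⟨rfl, rfl⟩ := Prod.mk.inj hg
      exact ⟨g, by simp [he]⟩
    · rintro ⟨g, hg⟩
      obtain ⟨h1, h2⟩ := Prod.mk.inj hg
      refine ⟨g, Prod.ext h1 (e.injective ?_)⟩
      rw [he]
      exact h2
  · rintro k ⟨p⟩
    rfl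

theorem tensor_sum (U : FinBiset H G) (X Y : FinGSet G) :
    (U.tensor (X.sum Y)).IsIso ((U.tensor X).sum (U.tensor Y)) := by
  let f : (U.tensor (X.sum Y)).carrier → ((U.tensor X).sum (U.tensor Y)).carrier :=
    Quotient.lift
      (fun p : U.carrier × (X.carrier ⊕ Y.carrier) =>
        (Sum.map (fun x => (Quotient.mk (U.tensorSetoid X) (p.1, x)))
          (fun y => (Quotient.mk (U.tensorSetoid Y) (p.1, y))) p.2 :
          Quotient (U.tensorSetoid X) ⊕ Quotient (U.tensorSetoid Y))) (by
        rintro ⟨u, x | y⟩ _ ⟨g, rfl⟩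
        · exact congrArg Sum.inl (Quotient.sound ⟨g, rfl⟩)
        · exact congrArg Sum.inr (Quotient.sound ⟨g, rfl⟩))
  let k : ((U.tensor X).sum (U.tensor Y)).carrier → (U.tensor (X.sum Y)).carrier :=
    Sum.elim
      (Quotient.map (fun p : U.carrier × X.carrier => (p.1, Sum.inl p.2)) (by
        rintro ⟨u, x⟩ _ ⟨g, rfl⟩
        exact ⟨g, rfl⟩))
      (Quotient.map (fun p : U.carrier × Y.carrier => (p.1, Sum.inr p.2)) (by
        rintro ⟨u, y⟩ _ ⟨g, rfl⟩
        exact ⟨g, rfl⟩))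
  refine ⟨⟨f, k, ?_, ?_⟩, ?_⟩
  · rintro ⟨u, x | y⟩ <;> rfl
  · rintro (⟨u, x⟩ | ⟨u, y⟩) <;> rfl
  · rintro h ⟨u, x | y⟩ <;> rfl

/-- The `(H × K, G × K)`-biset `U × K`, where `K` acts on both sides by multiplication on the
second component. -/
def prodGroup (K : Type u) [Group K] [Finite K] (U : FinBiset H G) :
    FinBiset (H × K) (G × K) where
  carrier := U.carrier × K
  left :=
    { smul := fun h p => (h.1 • p.1, h.2 * p.2)
      one_smul := fun p => Prod.ext (one_smul H p.1) (one_mul p.2)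
      mul_smul := fun h h' p => Prod.ext (mul_smul h.1 h'.1 p.1) (mul_assoc h.2 h'.2 p.2) }
  right :=
    { smul := fun g p => (op g.unop.1 • p.1, p.2 * g.unop.2)
      one_smul := fun p => Prod.ext (one_smul Gᵐᵒᵖ p.1) (mul_one p.2)
      mul_smul := fun g g' p =>
        Prod.ext (mul_smul (op g.unop.1) (op g'.unop.1) p.1)
          (mul_assoc p.2 g'.unop.2 g.unop.2).symm }
  comm :=
    @SMulCommClass.mk _ _ _ (_) (_) fun h g p => Prod.ext (smul_comm h.1 (op g.unop.1) p.1)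
      (mul_assoc h.2 p.2 g.unop.2).symm

end FinBiset

namespace Burnside

variable {F : Type v} [Field F] {G H : Type u} [Group G] [Group H]

/-- `𝔽B(U) : 𝔽B(G) → 𝔽B(H)`, `[X] ↦ [U ×_G X]`, for a finite `(H, G)`-biset `U`. -/
noncomputable def map (F : Type v) [Field F] {G H : Type u} [Group G] [Group H]
    (U : FinBiset H G) : Burnside F G →ₗ[F] Burnside F H :=
  lift (fun X => cls F (U.tensor X))
    (fun _ _ h => cls_eq_of_iso (U.tensor_iso h))
    (fun X Y => by rw [cls_eq_of_iso (U.tensor_sum X Y), cls_sum])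

/-- Restriction `𝔽B(G) → 𝔽B(H)` along a group homomorphism `f : H → G`. -/
noncomputable def res (F : Type v) [Field F] {G H : Type u} [Group G] [Group H] (f : H →* G) :
    Burnside F G →ₗ[F] Burnside F H :=
  lift (fun X => cls F (X.res f))
    (fun _ _ ⟨e, he⟩ => cls_eq_of_iso ⟨e, fun h x => he (f h) x⟩)
    (fun X Y => by
      rw [← cls_sum]
      exact cls_eq_of_iso ⟨Equiv.refl _, by rintro h (x | y) <;> rfl⟩)

/-- The bilinear product `𝔽B(G) × 𝔽B(H) → 𝔽B(G × H)`, `([X], [Y]) ↦ [X × Y]`. -/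
noncomputable def extProd (F : Type v) [Field F] (G H : Type u) [Group G] [Group H] :
    Burnside F G →ₗ[F] Burnside F H →ₗ[F] Burnside F (G × H) :=
  lift
    (fun X => lift (fun Y => cls F (X.prod Y))
      (fun _ _ ⟨e, he⟩ => cls_eq_of_iso
        ⟨Equiv.prodCongr (Equiv.refl _) e, fun g p => Prod.ext rfl (he g.2 p.2)⟩)
      (fun Y Y' => by
        rw [← cls_sum]
        exact cls_eq_of_iso ⟨Equiv.prodSumDistrib _ _ _, by rintro g ⟨x, y | y⟩ <;> rfl⟩))
    (fun X X' ⟨e, he⟩ => hom_ext fun Y => by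
      rw [lift_cls, lift_cls]
      exact cls_eq_of_iso
        ⟨Equiv.prodCongr e (Equiv.refl _), fun g p => Prod.ext (he g.1 p.1) rfl⟩)
    (fun X X' => hom_ext fun Y => by
      rw [LinearMap.add_apply, lift_cls, lift_cls, lift_cls, ← cls_sum]
      exact cls_eq_of_iso ⟨Equiv.sumProdDistrib _ _ _, by rintro g ⟨x | x, y⟩ <;> rfl⟩)

end Burnside

/-! ## The shifted Burnside functor and its ideals -/

/-- `𝔽B_K(G) = 𝔽B(G × K)`. -/
abbrev ShiftedBurnside (F : Type v) [Field F] (K G : Type u) [Group K] [Group G] :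
    Type (max (u + 1) v) :=
  Burnside F (G × K)

namespace ShiftedBurnside

/-- `𝔽B_K(U) = 𝔽B(U × K) : 𝔽B_K(G) → 𝔽B_K(H)`, for a finite `(H, G)`-biset `U`. -/
noncomputable def map (F : Type v) [Field F] (K : Type u) [Group K] [Finite K]
    {G H : Type u} [Group G] [Group H] (U : FinBiset H G) :
    ShiftedBurnside F K G →ₗ[F] ShiftedBurnside F K H :=
  Burnside.map F (U.prodGroup K)

/-- The embedding `((g, h), k) ↦ ((g, k), (h, k))` of `G × H × K` into `(G × K) × (H × K)`. Its
image is the subgroup `Δ`, and it is the inverse of the isomorphism `δ : Δ → G × H × K`. -/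
def diagonal (K G H : Type u) [Group K] [Group G] [Group H] :
    (G × H) × K →* (G × K) × (H × K) where
  toFun x := ((x.1.1, x.2), (x.1.2, x.2))
  map_one' := rfl
  map_mul' _ _ := rfl

/-- The product `𝔽B_K(G) × 𝔽B_K(H) → 𝔽B_K(G × H)`: the exterior product `α × β`, restricted
along the diagonal embedding (that is, restricted to `Δ` and transported by `δ`). -/
noncomputable def mul (F : Type v) [Field F] (K : Type u) [Group K]
    {G H : Type u} [Group G] [Group H] (a : ShiftedBurnside F K G) (b : ShiftedBurnside F K H) :
    ShiftedBurnside F K (G × H) :=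
  Burnside.res F (diagonal K G H) (Burnside.extProd F (G × K) (H × K) a b)

end ShiftedBurnside

/-- An ideal of the Green biset functor `𝔽B_K`: a biset subfunctor `I` of `𝔽B_K` which is an
`𝔽B_K`-submodule, i.e. `𝔽B_K(G) × I(H)` is mapped into `I(G × H)`. As each `I(G)` is a subspace,
stability under bisets is the same as stability under linear combinations of bisets. As the Green
functor `𝔽B_K` is commutative, left, right and two-sided ideals are the same. -/
@[ext]
structure GreenIdeal (F : Type v) [Field F] (K : Type u) [Group K] [Finite K] where
  obj : ∀ (G : Type u) [Group G] [Finite G], Submodule F (ShiftedBurnside F K G)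
  map_mem : ∀ (G H : Type u) [Group G] [Finite G] [Group H] [Finite H] (U : FinBiset H G)
    (x : ShiftedBurnside F K G), x ∈ obj G → ShiftedBurnside.map F K U x ∈ obj H
  mul_mem : ∀ (G H : Type u) [Group G] [Finite G] [Group H] [Finite H]
    (a : ShiftedBurnside F K G) (b : ShiftedBurnside F K H), b ∈ obj H →
    ShiftedBurnside.mul F K a b ∈ obj (G × H)

namespace GreenIdeal

variable {F : Type v} [Field F] {K : Type u} [Group K] [Finite K]

/-- Ideals are ordered by inclusion. -/
instance : PartialOrder (GreenIdeal F K) where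
  le I J := ∀ (G : Type u) [Group G] [Finite G], I.obj G ≤ J.obj G
  le_refl _ _ _ _ := le_rfl
  le_trans _ _ _ h h' G _ _ := (h G).trans (h' G)
  le_antisymm I J h h' := by
    ext1
    funext G _ _
    exact le_antisymm (h G) (h' G)

/-- The sum of a set of ideals: `(∑ I)(G) = ∑ I(G)`. -/
noncomputable instance : SupSet (GreenIdeal F K) where
  sSup A :=
    { obj := fun G _ _ => ⨆ I ∈ A, I.obj G
      map_mem := fun G H _ _ _ _ U x hx => by
        have key : (⨆ I ∈ A, I.obj G) ≤
            (⨆ I ∈ A, I.obj H).comap (ShiftedBurnside.map F K U) :=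
          iSup₂_le fun I hI y hy =>
            Submodule.mem_iSup_of_mem I (Submodule.mem_iSup_of_mem hI (I.map_mem G H U y hy))
        exact key hx
      mul_mem := fun G H _ _ _ _ a b hb => by
        have key : (⨆ I ∈ A, I.obj H) ≤ (⨆ I ∈ A, I.obj (G × H)).comap
            (Burnside.res F (ShiftedBurnside.diagonal K G H) ∘ₗ
              Burnside.extProd F (G × K) (H × K) a) :=
          iSup₂_le fun I hI y hy =>
            Submodule.mem_iSup_of_mem I (Submodule.mem_iSup_of_mem hI (I.mul_mem G H a y hy))
        exact key hb }

/-- The intersection of a set of ideals. -/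
noncomputable instance : InfSet (GreenIdeal F K) where
  sInf A :=
    { obj := fun G _ _ => ⨅ I ∈ A, I.obj G
      map_mem := fun G H _ _ _ _ U x hx => by
        simp only [Submodule.mem_iInf] at hx ⊢
        exact fun I hI => I.map_mem G H U x (hx I hI)
      mul_mem := fun G H _ _ _ _ a b hb => by
        simp only [Submodule.mem_iInf] at hb ⊢
        exact fun I hI => I.mul_mem G H a b (hb I hI) }

theorem isLUB_sSup (A : Set (GreenIdeal F K)) : IsLUB A (sSup A) :=
  ⟨fun I hI _ _ _ => le_iSup₂_of_le I hI le_rfl,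
    fun _ hJ G _ _ => iSup₂_le fun _ hI => hJ hI G⟩

theorem isGLB_sInf (A : Set (GreenIdeal F K)) : IsGLB A (sInf A) :=
  ⟨fun I hI _ _ _ => iInf₂_le_of_le I hI le_rfl,
    fun _ hJ G _ _ => le_iInf₂ fun _ hI => hJ hI G⟩

/-- The complete lattice of ideals: joins are sums, meets are intersections. -/
noncomputable instance : CompleteLattice (GreenIdeal F K) where
  sup I J := sSup {I, J}
  le_sup_left I J := (isLUB_sSup {I, J}).1 (by simp)
  le_sup_right I J := (isLUB_sSup {I, J}).1 (by simp)
  sup_le I J L h h' := (isLUB_sSup {I, J}).2 (by simp [h, h'])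
  inf I J := sInf {I, J}
  inf_le_left I J := (isGLB_sInf {I, J}).1 (by simp)
  inf_le_right I J := (isGLB_sInf {I, J}).1 (by simp)
  le_inf I J L h h' := (isGLB_sInf {J, L}).2 (by simp [h, h'])
  isLUB_sSup := isLUB_sSup
  isGLB_sInf := isGLB_sInf
  top := sInf ∅
  le_top I := (isGLB_sInf ∅).2 (by simp)
  bot := sSup ∅
  bot_le I := (isLUB_sSup ∅).2 (by simp)

/-- The ideal of `𝔽B_K` generated by an element of `𝔽B_K(G)`. -/
noncomputable def generatedBy {G : Type u} [Group G] [Finite G] (x : ShiftedBurnside F K G) :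
    GreenIdeal F K :=
  sInf {I | x ∈ I.obj G}

end GreenIdeal

/-! ## Möbius function, idempotents, and the numbers `m_{L,N}` -/

section Moebius

attribute [local instance] Fintype.ofFinite

open scoped Classical in
/-- The Möbius function `μ(X, L)` of the poset of subgroups of `G`. -/
noncomputable def moebius {G : Type u} [Group G] [Finite G] (X L : Subgroup G) : ℤ :=
  letI : LocallyFiniteOrder (Subgroup G) := Fintype.toLocallyFiniteOrder
  IncidenceAlgebra.mu ℤ X L

open scoped Classical in
/-- The primitive idempotent
`e_L^G = |N_G(L)|⁻¹ ∑_{X ≤ L} |X| μ(X, L) [G/X]` of the Burnside algebra `𝔽B(G)`. -/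
noncomputable def idempotent (F : Type v) [Field F] {G : Type u} [Group G] [Finite G]
    (L : Subgroup G) : Burnside F G :=
  (Nat.card (Subgroup.normalizer (L : Set G)) : F)⁻¹ •
    ∑ X : Subgroup G with X ≤ L,
      ((Nat.card X : F) * (moebius X L : F)) • Burnside.cls F (FinGSet.transitive X)

open scoped Classical in
/-- `m_{L,N} = |L|⁻¹ ∑_{X ≤ L, XN = L} |X| μ(X, L)`, for a normal subgroup `N` of `L`; then
`XN` is the join of `X` and `N`. -/
noncomputable def mNumber {L : Type u} [Group L] [Finite L] (N : Subgroup L) : ℚ :=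
  (Nat.card L : ℚ)⁻¹ *
    ∑ X : Subgroup L with X ⊔ N = ⊤, (Nat.card X : ℚ) * (moebius X ⊤ : ℚ)

end Moebius

/-! ## Groups over `K` -/

/-- A finite group over `K`: a pair `(L, φ)` with `φ : L → K` a group homomorphism. -/
structure GrpOver (K : Type u) [Group K] : Type (u + 1) where
  carrier : Type u
  [group : Group carrier]
  [finite : Finite carrier]
  hom : carrier →* K

attribute [instance] GrpOver.group GrpOver.finite

namespace GrpOver

variable {K : Type u} [Group K]

/-- Morphisms `(L, φ) → (L', φ')` are the group homomorphisms `f : L → L'` such that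
`i ∘ φ = φ' ∘ f` for some inner automorphism `i` of `K`. -/
instance : Category (GrpOver K) where
  Hom X Y := {f : X.carrier →* Y.carrier // ∃ k : K, ∀ l, MulAut.conj k (X.hom l) = Y.hom (f l)}
  id X := ⟨MonoidHom.id _, 1, fun l => by simp⟩
  comp f g := ⟨g.1.comp f.1, by
    obtain ⟨f, k, hk⟩ := f
    obtain ⟨g, k', hk'⟩ := g
    exact ⟨k' * k, fun l => by rw [map_mul, MulAut.mul_apply, hk, hk']; rfl⟩⟩

/-- `(L, φ) ↠ (L', φ')`: the group `(L', φ')` over `K` is a quotient of `(L, φ)`. -/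
def HasQuotient (X Y : GrpOver K) : Prop :=
  ∃ f : X ⟶ Y, Function.Surjective f.1

/-- `(L, φ)` is a `B_K`-group: `m_{L,N} = 0` for every non-trivial normal subgroup `N` of `L`
contained in `Ker φ`. -/
def IsBGroup (X : GrpOver K) : Prop :=
  ∀ N : Subgroup X.carrier, N.Normal → N ≠ ⊥ → N ≤ X.hom.ker → mNumber N = 0

/-- The ideal `𝖾_{L,φ}` of `𝔽B_K` generated by the idempotent `e_{L_φ}^{L × K}` of `𝔽B_K(L)`, where
`L_φ = {(l, φ(l)) | l ∈ L}` is the graph of `φ`. -/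
noncomputable def ideal (F : Type v) [Field F] [Finite K] (X : GrpOver K) : GreenIdeal F K :=
  GreenIdeal.generatedBy (G := X.carrier) (idempotent F X.hom.graph)

/-- `S` is a set of representatives of the isomorphism classes of groups over `K`. -/
def IsRepresentativeSet (S : Set (GrpOver K)) : Prop :=
  ∀ X : GrpOver K, ∃! Y : GrpOver K, Y ∈ S ∧ Nonempty (X ≅ Y)

/-- The subset of `S` consisting of the `B_K`-groups. -/
abbrev BGroups (S : Set (GrpOver K)) : Type (u + 1) :=
  {X : GrpOver K // X ∈ S ∧ X.IsBGroup}

/-- The complete lattice of closed subsets `P` of the set of `B_K`-groups of `S`, ordered by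
inclusion, with unions as joins and intersections as meets. Closed means: if `(L, φ) ∈ P`, `(M, ψ)`
is a `B_K`-group of `S` and `(M, ψ) ↠ (L, φ)`, then `(M, ψ) ∈ P`. -/
def closedSubsets (S : Set (GrpOver K)) : CompleteSublattice (Set (BGroups S)) :=
  CompleteSublattice.mk'
    {P | ∀ X ∈ P, ∀ Y : BGroups S, Y.1.HasQuotient X.1 → Y ∈ P}
    (fun A hA X hX Y h => by
      obtain ⟨P, hP, hXP⟩ := hX
      exact ⟨P, hP, hA hP X hXP Y h⟩)
    (fun A hA X hX Y h P hP => hA hP X (hX P hP) Y h)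

end GrpOver

end RelativeBGroups

open RelativeBGroups

/-! Everything is read off from marks, the linear extensions of `[X] ↦ |X^Y|`. In characteristic 0
an element of `𝔽B(G × K)` is a combination of the idempotents `e_Y` whose coefficients are its marks
up to nonzero factors (`eq_sum_mark_smul_idempotent`), and multiplying by `e_Y` isolates one mark.
Hence each `I(G)` is spanned by the idempotents it contains. Whether `e_Y` lies in `I(G)` depends
only on `Y` as a group over `K` via the second projection (`ideal_ofSubgroup_le_iff`).

A surjection `X ↠ Y` over `K` gives an inclusion of the ideal of `X` in that of `Y`, and this is an
equality for `Y = X/N` when `m_{X,N} ≠ 0`. Dividing out such `N` as long as possible replaces any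
group over `K` by a `B_K`-group with the same ideal (`exists_isBGroup`), so ideals are determined,
with their order, by the `B_K`-groups they contain.

It remains to see that summing the ideals of a closed set `P` brings in no further `B_K`-group. The
sum lies in the family of elements whose marks vanish at every `Y` having no quotient in `P`; the
main point is that this family is stable under bisets (`ofBGroups`). The mark at `Y` of the image of
`e_Z` is a sum over points `v` with `Yv = vZ`, weighted by `m_{Z,N}` with `N` the stabilizer of `v`
in `Z` (`card_normalizer_mul_mark_map_idempotent`). If it is nonzero, then `Y ↠ Z/N` for some `N`
with `m_{Z,N} ≠ 0`, and `exists_hom_of_mNumber_ne_zero` says that passing to such a `Z/N` loses no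
`B_K`-group quotient. Complete distributivity is then inherited from a lattice of sets closed under
arbitrary unions and intersections. -/

namespace RelativeBGroups

section Marks

attribute [local instance] Fintype.ofFinite

/-! ### Möbius functions of subgroup lattices -/

open scoped Classical in
theorem sum_moebius_left {G : Type u} [Group G] [Finite G] (X Y : Subgroup G) :
    ∑ W : Subgroup G with X ≤ W, moebius W Y = if X = Y then 1 else 0 := by
  let _ : LocallyFiniteOrder (Subgroup G) := Fintype.toLocallyFiniteOrder
  rw [← IncidenceAlgebra.sum_Icc_mu_left (𝕜 := ℤ) X Y]
  symm
  refine Finset.sum_subset (fun W hW => ?_) (fun W hW hW' => ?_)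
  · simpa using (Finset.mem_Icc.1 hW).1
  · refine IncidenceAlgebra.apply_eq_zero_of_not_le (fun h => hW' ?_) _
    simpa [h] using hW

open scoped Classical in
theorem sum_moebius_right {G : Type u} [Group G] [Finite G] (X Y : Subgroup G) :
    ∑ W : Subgroup G with W ≤ Y, moebius X W = if X = Y then 1 else 0 := by
  let _ : LocallyFiniteOrder (Subgroup G) := Fintype.toLocallyFiniteOrder
  rw [← IncidenceAlgebra.sum_Icc_mu_right (𝕜 := ℤ) X Y]
  symm
  refine Finset.sum_subset (fun W hW => ?_) (fun W hW hW' => ?_)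
  · simpa using (Finset.mem_Icc.1 hW).2
  · refine IncidenceAlgebra.apply_eq_zero_of_not_le (fun h => hW' ?_) _
    simpa [h] using hW

theorem moebius_eq_zero_of_not_le {G : Type u} [Group G] [Finite G] {X Y : Subgroup G}
    (h : ¬ X ≤ Y) : moebius X Y = 0 := by
  classical
  let _ : LocallyFiniteOrder (Subgroup G) := Fintype.toLocallyFiniteOrder
  exact IncidenceAlgebra.apply_eq_zero_of_not_le h _

theorem moebius_self {G : Type u} [Group G] [Finite G] (X : Subgroup G) : moebius X X = 1 := by
  classical
  exact @IncidenceAlgebra.mu_self ..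

/-- An embedding of subgroup posets whose image below `A T` is an upper set preserves
the Möbius function. -/
theorem moebius_map {G H : Type u} [Group G] [Finite G] [Group H] [Finite H]
    (A : Subgroup G ↪o Subgroup H) (T : Subgroup G)
    (hA : ∀ X W, A X ≤ W → W ≤ A T → ∃ X', A X' = W) (X : Subgroup G) :
    moebius (A X) (A T) = moebius X T := by
  classical
  induction X using WellFoundedGT.induction with
  | ind X ih =>
    have h1 := sum_moebius_left X T
    have h2 := sum_moebius_left (A X) (A T)
    have h3 : ∑ W : Subgroup H with A X ≤ W, moebius W (A T) =
        ∑ W : Subgroup G with X ≤ W, moebius (A W) (A T) := by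
      symm
      refine Finset.sum_of_injOn A A.injective.injOn ?_ ?_ (fun _ _ => rfl)
      · intro W hW
        simpa using hW
      · intro W hW hW'
        refine moebius_eq_zero_of_not_le fun h => hW' ?_
        obtain ⟨X', rfl⟩ := hA X W (by simpa using hW) h
        exact ⟨X', by simpa using hW, rfl⟩
    rw [h3] at h2
    simp only [EmbeddingLike.apply_eq_iff_eq] at h2
    rw [← h1] at h2
    have hX : X ∈ Finset.univ.filter (fun W => X ≤ W) := by simp
    rw [← Finset.add_sum_erase _ _ hX, ← Finset.add_sum_erase _ _ hX] at h2
    have h4 : ∑ W ∈ (Finset.univ.filter (fun W => X ≤ W)).erase X, moebius (A W) (A T) =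
        ∑ W ∈ (Finset.univ.filter (fun W => X ≤ W)).erase X, moebius W T := by
      refine Finset.sum_congr rfl fun W hW => ih W ?_
      simp only [Finset.mem_erase, Finset.mem_filter, Finset.mem_univ, true_and] at hW
      exact lt_of_le_of_ne hW.2 (Ne.symm hW.1)
    rw [h4] at h2
    exact add_right_cancel h2

theorem moebius_map_subtype {G : Type u} [Group G] [Finite G] (Z : Subgroup G) (X : Subgroup Z) :
    moebius (X.map Z.subtype) Z = moebius X ⊤ := by
  have h := moebius_map (OrderEmbedding.ofMapLEIff (fun X : Subgroup Z => X.map Z.subtype)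
    (fun X Y => Subgroup.map_le_map_iff_of_injective Z.subtype_injective)) ⊤ ?_ X
  · simpa [← MonoidHom.range_eq_map] using h
  · intro X W _ hW
    refine ⟨W.subgroupOf Z, ?_⟩
    simpa [← MonoidHom.range_eq_map, Subgroup.subgroupOf_map_subtype] using hW

theorem moebius_comap {G H : Type u} [Group G] [Finite G] [Group H] [Finite H] {f : G →* H}
    (hf : Function.Surjective f) (X Y : Subgroup H) :
    moebius (X.comap f) (Y.comap f) = moebius X Y := by
  refine moebius_map (OrderEmbedding.ofMapLEIff (fun X : Subgroup H => X.comap f)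
    (fun X Y => Subgroup.comap_le_comap_of_surjective hf)) Y ?_ X
  intro X W hW _
  exact ⟨W.map f, Subgroup.comap_map_eq_self ((Subgroup.ker_le_comap f X).trans hW)⟩

/-- A form of Weisner's theorem. -/
theorem sum_moebius_mul_inf_eq_zero {R : Type*} [CommRing R] {G : Type u} [Group G] [Finite G]
    {D Z : Subgroup G} (hD : D < Z) (f : Subgroup G → R) :
    ∑ X : Subgroup G, (moebius X Z : R) * f (X ⊓ D) = 0 := by
  classical
  -- It is enough that `μ(·, Z)` sums to zero on each fibre of `X ↦ X ⊓ D`. The total over all `W ≥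
  -- C` vanishes since `C < Z`, and the fibres over larger subgroups vanish by induction.
  have key : ∀ C : Subgroup G, ∑ X : Subgroup G with X ⊓ D = C, moebius X Z = 0 := by
    intro C
    induction C using WellFoundedGT.induction with
    | ind C ih =>
      by_cases hC : C ≤ D
      · have h1 := sum_moebius_left C Z
        rw [if_neg (ne_of_lt (hC.trans_lt hD))] at h1
        have h2 : ∑ W : Subgroup G with C ≤ W, moebius W Z =
            ∑ C' : Subgroup G with C ≤ C', ∑ X : Subgroup G with X ⊓ D = C', moebius X Z := by
          rw [← Finset.sum_fiberwise_of_maps_to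
            (t := Finset.univ.filter (fun C' => C ≤ C')) (g := fun X => X ⊓ D)]
          · refine Finset.sum_congr rfl fun C' hC' => Finset.sum_congr ?_ fun _ _ => rfl
            ext X
            simp only [Finset.mem_filter, Finset.mem_univ, true_and] at hC' ⊢
            exact ⟨fun h => h.2, fun h => ⟨(h ▸ hC').trans inf_le_left, h⟩⟩
          · intro X hX
            simpa [hC] using hX
        rw [h2, Finset.sum_eq_single_of_mem C (by simp)] at h1
        · exact h1
        · intro C' hC' hne
          simp only [Finset.mem_filter, Finset.mem_univ, true_and] at hC'
          exact ih C' (lt_of_le_of_ne hC' hne.symm)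
      · refine Finset.sum_eq_zero fun X hX => absurd ?_ hC
        simp only [Finset.mem_filter, Finset.mem_univ, true_and] at hX
        exact hX ▸ inf_le_right
  rw [← Finset.sum_fiberwise (g := fun X => X ⊓ D)]
  refine Finset.sum_eq_zero fun C _ => ?_
  have h : ∀ X ∈ Finset.univ.filter (fun X : Subgroup G => X ⊓ D = C),
      (moebius X Z : R) * f (X ⊓ D) = (moebius X Z : R) * f C := by
    intro X hX
    simp only [Finset.mem_filter, Finset.mem_univ, true_and] at hX
    rw [hX]
  rw [Finset.sum_congr rfl h, ← Finset.sum_mul, ← Int.cast_sum, key, Int.cast_zero, zero_mul]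

open scoped Classical in
/-- Weisner's theorem. -/
theorem sum_moebius_sup_eq_top {G : Type u} [Group G] [Finite G] (Z M : Subgroup G) :
    ∑ X : Subgroup G with X ⊔ M = ⊤, moebius Z X = if M ≤ Z then moebius Z ⊤ else 0 := by
  split_ifs with hM
  · rw [Finset.sum_eq_single_of_mem ⊤ (by simp)]
    intro X hX hne
    simp only [Finset.mem_filter, Finset.mem_univ, true_and] at hX
    refine moebius_eq_zero_of_not_le fun h => hne ?_
    rwa [sup_eq_left.2 (hM.trans h)] at hX
  -- The vanishing holds with any `C` in place of `⊤`, and this generality is what the induction on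
  -- `C` needs.
  · generalize (⊤ : Subgroup G) = C
    induction C using WellFoundedLT.induction with
    | ind C ih =>
      by_cases hC : M ≤ C
      · have h1 := sum_moebius_right Z C
        rw [if_neg (fun h : Z = C => hM (hC.trans h.ge))] at h1
        have h2 : ∑ W : Subgroup G with W ≤ C, moebius Z W =
            ∑ C' : Subgroup G with C' ≤ C, ∑ X : Subgroup G with X ⊔ M = C', moebius Z X := by
          rw [← Finset.sum_fiberwise_of_maps_to
            (t := Finset.univ.filter (fun C' => C' ≤ C)) (g := fun X => X ⊔ M)]
          · refine Finset.sum_congr rfl fun C' hC' => Finset.sum_congr ?_ fun _ _ => rfl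
            ext X
            simp only [Finset.mem_filter, Finset.mem_univ, true_and] at hC' ⊢
            exact ⟨fun h => h.2, fun h => ⟨le_sup_left.trans (h.trans_le hC'), h⟩⟩
          · intro X hX
            simpa [hC] using hX
        rw [h2, Finset.sum_eq_single_of_mem C (by simp)] at h1
        · exact h1
        · intro C' hC' hne
          simp only [Finset.mem_filter, Finset.mem_univ, true_and] at hC'
          exact ih C' (lt_of_le_of_ne hC' hne)
      · refine Finset.sum_eq_zero fun X hX => absurd ?_ hC
        simp only [Finset.mem_filter, Finset.mem_univ, true_and] at hX
        exact hX ▸ le_sup_right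

/-! ### The numbers `m_{L,N}` -/

open scoped Classical in
theorem card_mul_mNumber {L : Type u} [Group L] [Finite L] (N : Subgroup L) :
    (Nat.card L : ℚ) * mNumber N =
      ∑ X : Subgroup L with X ⊔ N = ⊤, (Nat.card X : ℚ) * (moebius X ⊤ : ℚ) := by
  rw [mNumber, mul_inv_cancel_left₀ (Nat.cast_ne_zero.2 Nat.card_pos.ne')]

-- Transports the sum from subgroups of `Z` to subgroups of the ambient group, where it can be
-- compared with the coefficients of the idempotent of `Z`.
open scoped Classical in
theorem card_mul_mNumber_subgroupOf {G : Type u} [Group G] [Finite G] (N Z : Subgroup G) :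
    (Nat.card Z : ℚ) * mNumber (N.subgroupOf Z) =
      ∑ X : Subgroup G with X ⊔ (N ⊓ Z) = Z, (Nat.card X : ℚ) * (moebius X Z : ℚ) := by
  have hmap (X : Subgroup Z) :
      X ⊔ N.subgroupOf Z = ⊤ ↔ X.map Z.subtype ⊔ (N ⊓ Z) = Z := by
    rw [← Subgroup.subgroupOf_map_subtype, ← Subgroup.map_sup]
    constructor
    · intro h
      rw [h, ← MonoidHom.range_eq_map, Subgroup.range_subtype]
    · intro h
      apply Subgroup.map_injective Z.subtype_injective
      rw [h, ← MonoidHom.range_eq_map, Subgroup.range_subtype]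
  rw [card_mul_mNumber]
  refine Finset.sum_nbij' (fun X => X.map Z.subtype) (fun X => X.subgroupOf Z) ?_ ?_ ?_ ?_ ?_
  · intro X hX
    simpa [hmap] using hX
  · intro X hX
    simp only [Finset.mem_filter, Finset.mem_univ, true_and] at hX ⊢
    rw [hmap, Subgroup.map_subgroupOf_eq_of_le (hX ▸ le_sup_left)]
    exact hX
  · intro X _
    exact Subgroup.comap_map_eq_self_of_injective Z.subtype_injective X
  · intro X hX
    simp only [Finset.mem_filter, Finset.mem_univ, true_and] at hX
    exact Subgroup.map_subgroupOf_eq_of_le (hX ▸ le_sup_left)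
  · intro X _
    rw [moebius_map_subtype, Subgroup.card_map_of_injective Z.subtype_injective]

theorem mNumber_bot (L : Type u) [Group L] [Finite L] : mNumber (⊥ : Subgroup L) = 1 := by
  classical
  have h := card_mul_mNumber (⊥ : Subgroup L)
  simp only [sup_bot_eq] at h
  rw [Finset.sum_eq_single_of_mem ⊤ (by simp) (by simp +contextual)] at h
  rw [moebius_self, Subgroup.card_top, Int.cast_one] at h
  exact mul_left_cancel₀ (Nat.cast_ne_zero.2 Nat.card_pos.ne') h

-- The correspondence theorem: taking preimages preserves the Möbius function and multiplies orders
-- by `|ker f|`.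
open scoped Classical in
theorem card_mul_mNumber_map {G L : Type u} [Group G] [Finite G] [Group L] [Finite L] {f : G →* L}
    (hf : Function.Surjective f) (N : Subgroup G) :
    (Nat.card G : ℚ) * mNumber (N.map f) =
      ∑ Z : Subgroup G with f.ker ≤ Z ∧ Z ⊔ N = ⊤, (Nat.card Z : ℚ) * (moebius Z ⊤ : ℚ) := by
  have hcard (X : Subgroup L) : Nat.card (X.comap f) = Nat.card f.ker * Nat.card X := by
    have h1 := (X.comap f).card_mul_index
    have h2 := f.ker.card_mul_index
    rw [Subgroup.index_comap_of_surjective X hf] at h1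
    rw [Subgroup.index_ker, MonoidHom.range_eq_top.2 hf, Subgroup.card_top, ← X.card_mul_index,
      ← mul_assoc, ← h1] at h2
    exact (Nat.eq_of_mul_eq_mul_right (Nat.pos_of_ne_zero Subgroup.index_ne_zero_of_finite) h2).symm
  have hG : (Nat.card G : ℚ) = Nat.card f.ker * Nat.card L := by
    have := hcard ⊤
    rw [Subgroup.comap_top, Subgroup.card_top, Subgroup.card_top] at this
    exact_mod_cast this
  rw [hG, mul_assoc, card_mul_mNumber, Finset.mul_sum]
  refine Finset.sum_nbij' (fun X => X.comap f) (fun X => X.map f) ?_ ?_ ?_ ?_ ?_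
  · intro X hX
    simp only [Finset.mem_filter, Finset.mem_univ, true_and] at hX ⊢
    refine ⟨Subgroup.ker_le_comap f X, ?_⟩
    have h := congrArg (Subgroup.comap f) hX
    rw [← Subgroup.comap_sup_eq _ _ _ hf, Subgroup.comap_map_eq, Subgroup.comap_top,
      sup_comm N, ← sup_assoc, sup_eq_left.2 (Subgroup.ker_le_comap f X)] at h
    exact h
  · intro X hX
    simp only [Finset.mem_filter, Finset.mem_univ, true_and] at hX ⊢
    rw [← Subgroup.map_sup, hX.2, Subgroup.map_top_of_surjective f hf]
  · intro X _
    exact Subgroup.map_comap_eq_self_of_surjective hf X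
  · intro X hX
    simp only [Finset.mem_filter, Finset.mem_univ, true_and] at hX
    exact Subgroup.comap_map_eq_self hX.1
  · intro X _
    rw [hcard, ← moebius_comap hf, Subgroup.comap_top, Nat.cast_mul, mul_assoc]

theorem mNumber_map_equiv {G L : Type u} [Group G] [Finite G] [Group L] [Finite L] (e : G ≃* L)
    (N : Subgroup G) : mNumber (N.map e.toMonoidHom) = mNumber N := by
  classical
  have h := card_mul_mNumber_map (f := e.toMonoidHom) e.surjective N
  have hk : e.toMonoidHom.ker = ⊥ := (MonoidHom.ker_eq_bot_iff _).2 e.injective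
  simp only [hk, bot_le, true_and] at h
  rw [← card_mul_mNumber] at h
  exact mul_left_cancel₀ (Nat.cast_ne_zero.2 Nat.card_pos.ne') h

open scoped Classical in
/-- The sum of the numbers `|X| m_{X, X ∩ N}` over the common supplements of `ker f` and `N`. -/
theorem sum_card_mul_mNumber_subgroupOf {G L : Type u} [Group G] [Finite G] [Group L] [Finite L]
    {f : G →* L} (hf : Function.Surjective f) (N : Subgroup G) [N.Normal] :
    ∑ X : Subgroup G with X ⊔ f.ker = ⊤ ∧ X ⊔ N = ⊤,
      (Nat.card X : ℚ) * mNumber (N.subgroupOf X) = (Nat.card G : ℚ) * mNumber (N.map f) := by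
  have h1 (X : Subgroup G) (hX : X ⊔ N = ⊤) : (Nat.card X : ℚ) * mNumber (N.subgroupOf X) =
      ∑ Z : Subgroup G with Z ⊔ N = ⊤, (Nat.card Z : ℚ) * (moebius Z X : ℚ) := by
    rw [card_mul_mNumber_subgroupOf]
    -- Dedekind's modular law, given that `XN` is the whole group.
    have (Z : Subgroup G) (hZ : Z ≤ X) : Z ⊔ (N ⊓ X) = X ↔ Z ⊔ N = ⊤ := by
      constructor
      · intro h
        refine top_le_iff.1 ?_
        rw [← hX, ← h, sup_assoc]
        exact sup_le_sup_left (sup_le inf_le_left le_rfl) Z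
      · intro h
        refine le_antisymm (sup_le hZ inf_le_right) fun x hx => ?_
        obtain ⟨z, hz, n, hn, rfl⟩ := Subgroup.mem_sup_of_normal_right.1
          (h ▸ Subgroup.mem_top x : x ∈ Z ⊔ N)
        exact Subgroup.mul_mem_sup hz ⟨hn, ((X.mul_mem_cancel_left (hZ hz)).1 hx)⟩
    rw [Finset.sum_filter, Finset.sum_filter]
    refine Finset.sum_congr rfl fun Z _ => ?_
    by_cases hZ : Z ≤ X
    · simp only [this Z hZ]
    · simp [moebius_eq_zero_of_not_le hZ]
  rw [card_mul_mNumber_map hf]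
  -- The condition on `X ⊔ N` may be dropped: a nonzero `μ(Z, X)` forces `Z ≤ X`, and `Z` already
  -- supplements `N`.
  have h2 : ∑ X : Subgroup G with X ⊔ f.ker = ⊤ ∧ X ⊔ N = ⊤,
      (Nat.card X : ℚ) * mNumber (N.subgroupOf X) =
      ∑ X : Subgroup G with X ⊔ f.ker = ⊤,
        ∑ Z : Subgroup G with Z ⊔ N = ⊤, (Nat.card Z : ℚ) * (moebius Z X : ℚ) := by
    rw [← Finset.filter_filter, Finset.sum_filter]
    refine Finset.sum_congr rfl fun X _ => ?_
    split_ifs with hX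
    · exact h1 X hX
    · symm
      refine Finset.sum_eq_zero fun Z hZ => ?_
      simp only [Finset.mem_filter, Finset.mem_univ, true_and] at hZ
      rw [moebius_eq_zero_of_not_le, Int.cast_zero, mul_zero]
      exact fun h => hX (top_le_iff.1 (hZ ▸ sup_le_sup_right h N))
  -- With `Z` fixed, Weisner's theorem for `ker f` retains exactly the `Z` containing `ker f`.
  rw [h2, Finset.sum_comm]
  simp only [← Finset.mul_sum, ← Int.cast_sum, sum_moebius_sup_eq_top]
  rw [Finset.sum_filter, Finset.sum_filter]
  refine Finset.sum_congr rfl fun Z _ => ?_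
  by_cases hZ : f.ker ≤ Z <;> simp [hZ]

/-! ### Quotients of groups over `K` -/

namespace GrpOver

variable {K : Type u} [Group K]

theorem HasQuotient.refl (X : GrpOver K) : X.HasQuotient X :=
  ⟨𝟙 X, fun x => ⟨x, rfl⟩⟩

theorem HasQuotient.trans {X Y Z : GrpOver K} (h : X.HasQuotient Y) (h' : Y.HasQuotient Z) :
    X.HasQuotient Z := by
  obtain ⟨f, hf⟩ := h
  obtain ⟨g, hg⟩ := h'
  exact ⟨f ≫ g, hg.comp hf⟩

theorem HasQuotient.of_iso {X Y : GrpOver K} (e : X ≅ Y) : X.HasQuotient Y :=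
  ⟨e.hom, fun y => ⟨e.inv.1 y, congrArg (fun f : Y ⟶ Y => f.1 y) e.inv_hom_id⟩⟩

theorem IsBGroup.of_iso {X Y : GrpOver K} (e : X ≅ Y) (h : X.IsBGroup) : Y.IsBGroup := by
  have h1 : ∀ x, e.inv.1 (e.hom.1 x) = x :=
    fun x => congrArg (fun f : X ⟶ X => f.1 x) e.hom_inv_id
  have h2 : ∀ y, e.hom.1 (e.inv.1 y) = y :=
    fun y => congrArg (fun f : Y ⟶ Y => f.1 y) e.inv_hom_id
  let e' : Y.carrier ≃* X.carrier :=
    { e.inv.1 with invFun := e.hom.1, left_inv := h2, right_inv := h1 }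
  intro N hN hne hk
  rw [← mNumber_map_equiv e']
  refine h _ (hN.map _ e'.surjective) (fun h' => hne ?_) ?_
  · exact (Subgroup.map_eq_bot_iff_of_injective N (f := e'.toMonoidHom) e'.injective).1 h'
  · rintro _ ⟨n, hn, rfl⟩
    obtain ⟨k, hk'⟩ := e.inv.2
    have := hk' n
    rw [MonoidHom.mem_ker.1 (hk hn), map_one] at this
    exact this.symm

/-- The quotient of a group over `K` by a normal subgroup contained in the kernel. -/
def quotient (X : GrpOver K) (N : Subgroup X.carrier) [N.Normal] (hN : N ≤ X.hom.ker) :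
    GrpOver K where
  carrier := X.carrier ⧸ N
  hom := QuotientGroup.lift N X.hom hN

theorem hasQuotient_quotient (X : GrpOver K) (N : Subgroup X.carrier) [N.Normal]
    (hN : N ≤ X.hom.ker) : X.HasQuotient (X.quotient N hN) :=
  ⟨⟨QuotientGroup.mk' N, 1, fun l => by
    rw [map_one]
    rfl⟩, QuotientGroup.mk'_surjective N⟩

/-- If `L` is a `B_K`-group and `m_{W,N} ≠ 0`, then `W ↠ L` implies `W / N ↠ L`. -/
theorem exists_hom_of_mNumber_ne_zero {L : GrpOver K} (hL : L.IsBGroup) :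
    ∀ (n : ℕ) (W : GrpOver K), Nat.card W.carrier = n → W.HasQuotient L →
      ∀ N : Subgroup W.carrier, N.Normal → N ≤ W.hom.ker → mNumber N ≠ 0 →
        ∃ f : W ⟶ L, Function.Surjective f.1 ∧ N ≤ f.1.ker := by
  classical
  intro n
  induction n using Nat.strong_induction_on with
  | _ n ih =>
    intro W hW ⟨f, hf⟩ N hN hNK hm
    by_cases hNf : N ≤ f.1.ker
    · exact ⟨f, hf, hNf⟩
    obtain ⟨k, hk⟩ := f.2
    -- The image of `N` is a nontrivial normal subgroup in the kernel of the structure map of a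
    -- `B_K`-group.
    have h0 : mNumber (N.map f.1) = 0 := by
      refine hL _ (hN.map _ hf) (fun h => hNf ((Subgroup.map_eq_bot_iff _).1 h)) ?_
      rintro _ ⟨x, hx, rfl⟩
      have := hk x
      rw [MonoidHom.mem_ker.1 (hNK hx), map_one] at this
      exact this.symm
    have hsum := sum_card_mul_mNumber_subgroupOf hf N
    rw [h0, mul_zero] at hsum
    have htop : ⊤ ∈ Finset.univ.filter
        (fun X : Subgroup W.carrier => X ⊔ f.1.ker = ⊤ ∧ X ⊔ N = ⊤) := by simp
    have hmtop : mNumber (N.subgroupOf ⊤) ≠ 0 := by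
      rw [← mNumber_map_equiv Subgroup.topEquiv]
      convert hm
      exact Subgroup.map_subgroupOf_eq_of_le le_top
    -- The sum over common supplements is zero, but its term at `X = ⊤` is not, so some proper
    -- supplement also contributes. It still maps onto `L`, and the induction applies to it.
    obtain ⟨X, hX, hX'⟩ : ∃ X ∈ (Finset.univ.filter
        (fun X : Subgroup W.carrier => X ⊔ f.1.ker = ⊤ ∧ X ⊔ N = ⊤)).erase ⊤,
          (Nat.card X : ℚ) * mNumber (N.subgroupOf X) ≠ 0 := by
      apply Finset.exists_ne_zero_of_sum_ne_zero
      intro h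
      rw [← Finset.add_sum_erase _ _ htop, h, add_zero] at hsum
      exact mul_ne_zero (Nat.cast_ne_zero.2 Nat.card_pos.ne') hmtop hsum
    simp only [Finset.mem_erase, Finset.mem_filter, Finset.mem_univ, true_and] at hX
    obtain ⟨hXtop, hXf, hXN⟩ := hX
    let X' : GrpOver K := ⟨X, W.hom.comp X.subtype⟩
    have hcard : Nat.card X < n := by
      rw [← hW]
      refine lt_of_le_of_ne (Nat.le_of_dvd Nat.card_pos X.card_subgroup_dvd_card) fun h => hXtop ?_
      exact Subgroup.eq_top_of_card_eq X h
    have hXL : X'.HasQuotient L := by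
      refine ⟨⟨f.1.comp X.subtype, k, fun l => hk l⟩, fun l => ?_⟩
      obtain ⟨w, rfl⟩ := hf l
      obtain ⟨x, hx, y, hy, rfl⟩ := Subgroup.mem_sup_of_normal_right.1
        (hXf ▸ Subgroup.mem_top w : w ∈ X ⊔ f.1.ker)
      refine ⟨⟨x, hx⟩, ?_⟩
      rw [map_mul, MonoidHom.mem_ker.1 hy, mul_one]
      rfl
    obtain ⟨g, hg, hgN⟩ := ih _ hcard X' rfl hXL (N.subgroupOf X) inferInstance
      (fun x hx => hNK hx) (right_ne_zero_of_mul hX')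
    obtain ⟨k', hk'⟩ := g.2
    -- As `XN = W`, the quotient `W/N` is `X/(X ∩ N)`; the surjection `g` kills `X ∩ N`, hence
    -- descends to `W/N`.
    let π : X →* W.carrier ⧸ N := (QuotientGroup.mk' N).comp X.subtype
    have hπ : Function.Surjective π := by
      intro w
      obtain ⟨w, rfl⟩ := QuotientGroup.mk'_surjective N w
      obtain ⟨x, hx, y, hy, rfl⟩ := Subgroup.mem_sup_of_normal_right.1
        (hXN ▸ Subgroup.mem_top w : w ∈ X ⊔ N)
      exact ⟨⟨x, hx⟩, (QuotientGroup.mk_mul_of_mem x hy).symm⟩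
    have hker : π.ker ≤ MonoidHom.ker (G := X) g.1 := by
      intro x hx
      exact hgN ((QuotientGroup.eq_one_iff (N := N) x.1).1 hx)
    let h : W.carrier →* L.carrier :=
      (π.liftOfSurjective hπ ⟨g.1, hker⟩).comp (QuotientGroup.mk' N)
    have hh : ∀ x : X, h x.1 = g.1 x := fun x =>
      π.liftOfRightInverse_comp_apply _ (Function.rightInverse_surjInv hπ) ⟨g.1, hker⟩ x
    have hhN : N ≤ h.ker := by
      intro y hy
      rw [MonoidHom.mem_ker, MonoidHom.comp_apply, QuotientGroup.mk'_apply,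
        (QuotientGroup.eq_one_iff y).2 hy, map_one]
    refine ⟨⟨h, k', fun w => ?_⟩, fun l => ?_, hhN⟩
    · obtain ⟨x, hx, y, hy, rfl⟩ := Subgroup.mem_sup_of_normal_right.1
        (hXN ▸ Subgroup.mem_top w : w ∈ X ⊔ N)
      rw [map_mul, MonoidHom.mem_ker.1 (hNK hy), mul_one, map_mul, MonoidHom.mem_ker.1 (hhN hy),
        mul_one, hh ⟨x, hx⟩]
      exact hk' ⟨x, hx⟩
    · obtain ⟨x, hx⟩ := hg l
      exact ⟨x.1, (hh x).trans hx⟩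

end GrpOver

/-! ### Marks and the idempotent expansion -/

namespace FinGSet

variable {G : Type u} [Group G]

/-- The fixed points of a subgroup on a finite `G`-set. -/
def fixedBy (Y : Subgroup G) (X : FinGSet G) : Set X.carrier :=
  {x | ∀ y ∈ Y, y • x = x}

/-- The `G`-set on an invariant subset of a finite `G`-set. -/
def sub (X : FinGSet G) (s : Set X.carrier) (hs : ∀ (g : G), ∀ x ∈ s, g • x ∈ s) :
    FinGSet G where
  carrier := s
  action :=
    { smul := fun g x => ⟨g • x.1, hs g x.1 x.2⟩
      one_smul := fun x => Subtype.ext (one_smul G x.1)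
      mul_smul := fun g h x => Subtype.ext (mul_smul g h x.1) }

theorem isIso_sum_sub (X : FinGSet G) (s : Set X.carrier) (hs : ∀ (g : G), ∀ x ∈ s, g • x ∈ s)
    (hs' : ∀ (g : G), ∀ x ∈ sᶜ, g • x ∈ sᶜ) : ((X.sub s hs).sum (X.sub sᶜ hs')).IsIso X := by
  classical
  exact ⟨Equiv.Set.sumCompl s, by rintro g (x | x) <;> rfl⟩

end FinGSet

namespace Burnside

variable {F : Type v} [Field F] {G H : Type u} [Group G] [Group H]

/-- The mark homomorphism `[X] ↦ |X^Y|`. -/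
noncomputable def mark (F : Type v) [Field F] (Y : Subgroup G) : Burnside F G →ₗ[F] F :=
  lift (fun X => (Nat.card (X.fixedBy Y) : F))
    (fun X X' ⟨e, he⟩ => congrArg Nat.cast (Nat.card_congr (e.subtypeEquiv fun x =>
      forall₂_congr fun y _ => by rw [← he, e.apply_eq_iff_eq])))
    (fun X X' => by
      rw [← Nat.cast_add, ← Nat.card_sum]
      refine congrArg Nat.cast (Nat.card_congr (Equiv.subtypeSum.trans (Equiv.sumCongr ?_ ?_)))
      · exact Equiv.subtypeEquivRight fun x => forall₂_congr fun y _ => Sum.inl_injective.eq_iff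
      · exact Equiv.subtypeEquivRight fun x => forall₂_congr fun y _ => Sum.inr_injective.eq_iff)

theorem mark_cls (Y : Subgroup G) (X : FinGSet G) :
    mark F Y (cls F X) = (Nat.card (X.fixedBy Y) : F) :=
  lift_cls ..

theorem cls_eq_zero_of_isEmpty (X : FinGSet G) [IsEmpty X.carrier] : cls F X = 0 := by
  have h := cls_sum (F := F) X X
  have h' : (X.sum X).IsIso X := by
    have : IsEmpty (X.sum X).carrier := inferInstanceAs (IsEmpty (X.carrier ⊕ X.carrier))
    exact ⟨Equiv.equivOfIsEmpty _ _, fun _ x => isEmptyElim x⟩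
  rw [cls_eq_of_iso h'] at h
  exact left_eq_add.1 h

/-- The decomposition of a finite `G`-set as the disjoint union of its orbits. -/
theorem cls_eq_sum_stabilizer [CharZero F] [Finite G] (S : FinGSet G) :
    cls F S = ∑ s : S.carrier, ((Nat.card (MulAction.stabilizer G s) : F) / Nat.card G) •
      cls F (FinGSet.transitive (MulAction.stabilizer G s)) := by
  classical
  induction hn : Nat.card S.carrier using Nat.strong_induction_on generalizing S with
  | _ n ih =>
    rcases isEmpty_or_nonempty S.carrier with hS | ⟨⟨s⟩⟩
    · rw [cls_eq_zero_of_isEmpty, Finset.univ_eq_empty, Finset.sum_empty]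
    · let O : Set S.carrier := MulAction.orbit G s
      have hO : ∀ (g : G), ∀ x ∈ O, g • x ∈ O := fun g x hx => MulAction.mem_orbit_of_mem_orbit g hx
      have hO' : ∀ (g : G), ∀ x ∈ Oᶜ, g • x ∈ Oᶜ := fun g x hx h =>
        hx (by simpa using hO g⁻¹ _ h)
      have hlt : Nat.card (S.sub Oᶜ hO').carrier < n := by
        rw [← hn]
        exact Finite.card_subtype_lt (x := s) (fun h => h (MulAction.mem_orbit_self s))
      have hstab (s' : S.carrier) (x : (S.sub Oᶜ hO').carrier) (h : x.1 = s') :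
          MulAction.stabilizer G x = MulAction.stabilizer G s' := by
        subst h
        ext g
        exact Subtype.ext_iff
      have horb : cls F (S.sub O hO) = ∑ x : O,
          ((Nat.card (MulAction.stabilizer G x.1) : F) / Nat.card G) •
            cls F (FinGSet.transitive (MulAction.stabilizer G x.1)) := by
        -- Each point of the orbit contributes the same share `|O|⁻¹` of its class.
        have hx (x : O) : ((Nat.card (MulAction.stabilizer G x.1) : F) / Nat.card G) •
            cls F (FinGSet.transitive (MulAction.stabilizer G x.1)) =
            (Nat.card O : F)⁻¹ • cls F (S.sub O hO) := by
          have hox : MulAction.orbit G x.1 = O := MulAction.orbit_eq_iff.2 x.2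
          congr 1
          · have h := (MulAction.stabilizer G x.1).card_eq_card_quotient_mul_card_subgroup
            rw [← Nat.card_congr (MulAction.orbitEquivQuotientStabilizer G x.1), hox] at h
            have h0 : (Nat.card (MulAction.stabilizer G x.1) : F) ≠ 0 :=
              Nat.cast_ne_zero.2 Nat.card_pos.ne'
            rw [h, Nat.cast_mul, div_mul_cancel_right₀ h0]
          · refine cls_eq_of_iso ⟨((MulAction.orbitEquivQuotientStabilizer G x.1).symm.trans
              (Equiv.setCongr hox)), ?_⟩
            intro g y
            induction y using QuotientGroup.induction_on with
            | H y => exact Subtype.ext (mul_smul g y x.1)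
        rw [Finset.sum_congr rfl fun x _ => hx x, Finset.sum_const, Finset.card_univ,
          ← Nat.card_eq_fintype_card, ← Nat.cast_smul_eq_nsmul F, smul_smul, mul_inv_cancel₀,
          one_smul]
        have : Nonempty O := ⟨⟨s, MulAction.mem_orbit_self s⟩⟩
        exact Nat.cast_ne_zero.2 Nat.card_pos.ne'
      have hcompl : ∑ x : (S.sub Oᶜ hO').carrier,
          ((Nat.card (MulAction.stabilizer G x) : F) / Nat.card G) •
            cls F (FinGSet.transitive (MulAction.stabilizer G x)) =
          ∑ x : {x // x ∉ O}, ((Nat.card (MulAction.stabilizer G x.1) : F) / Nat.card G) •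
            cls F (FinGSet.transitive (MulAction.stabilizer G x.1)) :=
        Fintype.sum_equiv (show (S.sub Oᶜ hO').carrier ≃ {x // x ∉ O} from Equiv.refl _) _ _
          fun x => by
          rw [hstab x.1 x rfl]
          rfl
      rw [← cls_eq_of_iso (S.isIso_sum_sub O hO hO'), cls_sum, horb, ih _ hlt _ rfl, hcompl,
        ← Fintype.sum_subtype_add_sum_subtype (fun x => x ∈ O)]

/-- Every element of the Burnside algebra is a combination of the idempotents, with coefficients
given by its marks. -/
theorem eq_sum_mark_smul_idempotent [CharZero F] [Finite G] (x : Burnside F G) :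
    x = ∑ Y : Subgroup G, ((Nat.card (Subgroup.normalizer (Y : Set G)) : F) / Nat.card G *
      mark F Y x) • idempotent F Y := by
  classical
  let Φ : Burnside F G →ₗ[F] Burnside F G := ∑ Y : Subgroup G,
    ((Nat.card (Subgroup.normalizer (Y : Set G)) : F) / Nat.card G) •
      (mark F Y).smulRight (idempotent F Y)
  have hΦ (x : Burnside F G) : Φ x = ∑ Y : Subgroup G,
      ((Nat.card (Subgroup.normalizer (Y : Set G)) : F) / Nat.card G *
        mark F Y x) • idempotent F Y := by
    simp [Φ, mul_smul]
  have key : LinearMap.id = Φ := by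
    refine hom_ext fun S => ?_
    rw [hΦ, LinearMap.id_apply]
    have h1 (Y : Subgroup G) : ((Nat.card (Subgroup.normalizer (Y : Set G)) : F) / Nat.card G *
        mark F Y (cls F S)) • idempotent F Y = ∑ s : S.carrier, ∑ X : Subgroup G,
          if Y ≤ MulAction.stabilizer G s then
            ((moebius X Y : ℤ) : F) • ((Nat.card X : F) / Nat.card G) •
              cls F (FinGSet.transitive X) else 0 := by
      have hN : (Nat.card (Subgroup.normalizer (Y : Set G)) : F) ≠ 0 :=
        Nat.cast_ne_zero.2 Nat.card_pos.ne'
      have hcard : (Nat.card (S.fixedBy Y) : F) =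
          ((Finset.univ.filter fun s : S.carrier => Y ≤ MulAction.stabilizer G s).card : F) := by
        rw [← Fintype.card_subtype, ← Nat.card_eq_fintype_card]
        rfl
      have hsum (c : F) : c • (∑ X : Subgroup G with X ≤ Y,
          ((Nat.card X : F) * (moebius X Y : F)) • cls F (FinGSet.transitive X)) =
          ∑ X : Subgroup G, (c * (moebius X Y : F) * (Nat.card X : F)) •
            cls F (FinGSet.transitive X) := by
        rw [Finset.sum_filter, Finset.smul_sum]
        refine Finset.sum_congr rfl fun X _ => ?_
        split_ifs with h
        · rw [smul_smul, mul_comm (Nat.card X : F), mul_assoc]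
        · simp [moebius_eq_zero_of_not_le h]
      rw [idempotent, mark_cls, hcard, smul_smul, hsum, Finset.sum_comm]
      refine Finset.sum_congr rfl fun X _ => ?_
      rw [← Finset.sum_filter, Finset.sum_const, ← Nat.cast_smul_eq_nsmul F, smul_smul, smul_smul]
      congr 1
      field_simp
    rw [Finset.sum_congr rfl fun Y _ => h1 Y, Finset.sum_comm, cls_eq_sum_stabilizer]
    refine Finset.sum_congr rfl fun s _ => ?_
    rw [Finset.sum_comm]
    -- Möbius inversion: summing `μ(X, Y)` over `Y` below the stabilizer of `s` leaves only `X`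
    -- equal to it.
    have h2 (X : Subgroup G) : (∑ Y : Subgroup G, if Y ≤ MulAction.stabilizer G s then
            ((moebius X Y : ℤ) : F) • ((Nat.card X : F) / Nat.card G) •
              cls F (FinGSet.transitive X) else 0) =
        if X = MulAction.stabilizer G s then ((Nat.card X : F) / Nat.card G) •
              cls F (FinGSet.transitive X) else 0 := by
      rw [← Finset.sum_filter, ← Finset.sum_smul, ← Int.cast_sum, sum_moebius_right]
      split_ifs <;> simp
    rw [Finset.sum_congr rfl fun X _ => h2 X, Finset.sum_ite_eq' Finset.univ,
      if_pos (Finset.mem_univ _)]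
  rw [← hΦ, ← key, LinearMap.id_apply]

theorem eq_of_mark_eq [CharZero F] [Finite G] {x y : Burnside F G}
    (h : ∀ Y : Subgroup G, mark F Y x = mark F Y y) : x = y := by
  rw [eq_sum_mark_smul_idempotent x, eq_sum_mark_smul_idempotent y]
  simp only [h]

end Burnside

/-! ### Marks of the image of an idempotent under a biset -/

namespace FinBiset

variable {G H : Type u} [Group G] [Group H] (V : FinBiset H G)

/-- The stabilizer of a point of a biset for the right action. -/
def rightStabilizer (v : V.carrier) : Subgroup G :=
  (MulAction.stabilizer Gᵐᵒᵖ v).unop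

/-- `Y v = v Z`, for a point `v` of an `(H, G)`-biset and subgroups `Y` of `H` and `Z` of `G`. -/
def Linked (Y : Subgroup H) (v : V.carrier) (Z : Subgroup G) : Prop :=
  (∀ y ∈ Y, ∃ z ∈ Z, y • v = op z • v) ∧ ∀ z ∈ Z, ∃ y ∈ Y, y • v = op z • v

-- Every class in `V ×_G G/X` has a representative `(v, X)`, so the tensor product is `V/X`.
-- Weighting each `v` by its stabilizer in `X` makes every `X`-orbit count `|X|`, by orbit counting.
open scoped Classical in
theorem card_mul_card_fixedBy_tensor [Finite G] (Y : Subgroup H) (X : Subgroup G) :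
    Nat.card X * Nat.card ((V.tensor (FinGSet.transitive X)).fixedBy Y) =
      ∑ v : V.carrier, if ∀ y ∈ Y, ∃ x ∈ X, y • v = op x • v then
        Nat.card (X ⊓ V.rightStabilizer v : Subgroup G) else 0 := by
  let T : FinGSet H := V.tensor (FinGSet.transitive X)
  let π : V.carrier → T.carrier := fun v =>
    Quotient.mk (V.tensorSetoid (FinGSet.transitive X)) (v, ((1 : G) : G ⧸ X))
  have hπ (v v' : V.carrier) : π v = π v' ↔ ∃ x ∈ X, v' = op x • v := by
    have h (g : G) : ((1 : G) : G ⧸ X) = g⁻¹ • ((1 : G) : G ⧸ X) ↔ g ∈ X := by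
      rw [MulAction.Quotient.smul_coe, QuotientGroup.eq, smul_eq_mul]
      simp
    refine Quotient.eq.trans ⟨?_, ?_⟩
    · rintro ⟨g, hg⟩
      obtain ⟨h1, h2⟩ := Prod.mk.inj hg
      exact ⟨g, (h g).1 h2, h1⟩
    · rintro ⟨x, hx, rfl⟩
      exact ⟨x, Prod.ext rfl ((h x).2 hx)⟩
  have hsurj : Function.Surjective π := by
    rintro ⟨⟨v, g⟩⟩
    induction g using QuotientGroup.induction_on with
    | H g =>
      refine ⟨op g • v, Quotient.sound ⟨g⁻¹, Prod.ext ?_ ?_⟩⟩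
      · simp
      · change ((g : G) : G ⧸ X) = (g⁻¹)⁻¹ • ((1 : G) : G ⧸ X)
        rw [MulAction.Quotient.smul_coe, smul_eq_mul, inv_inv, mul_one]
  have hfix (v : V.carrier) : π v ∈ T.fixedBy Y ↔ ∀ y ∈ Y, ∃ x ∈ X, y • v = op x • v := by
    refine forall₂_congr fun y _ => ?_
    rw [← hπ]
    exact eq_comm
  have hfib (t : T.carrier) : (∑ v : V.carrier, if t = π v then
      Nat.card (X ⊓ V.rightStabilizer v : Subgroup G) else 0) = Nat.card X := by
    obtain ⟨v₀, rfl⟩ := hsurj t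
    let f : X → V.carrier := fun x => op x.1 • v₀
    rw [← Nat.card_congr (Equiv.sigmaFiberEquiv f), Nat.card_sigma]
    refine Finset.sum_congr rfl fun v _ => ?_
    split_ifs with h
    · obtain ⟨x₁, hx₁, rfl⟩ := (hπ _ _).1 h
      refine Nat.card_congr ⟨fun x => ⟨⟨x₁ * x.1, X.mul_mem hx₁ x.2.1⟩, ?_⟩,
        fun x => ⟨x₁⁻¹ * x.1.1, X.mul_mem (X.inv_mem hx₁) x.1.2, ?_⟩, fun x => ?_, fun x => ?_⟩
      · change op (x₁ * x.1) • v₀ = op x₁ • v₀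
        rw [op_mul, mul_smul]
        exact x.2.2
      · change op (x₁⁻¹ * x.1.1) • op x₁ • v₀ = op x₁ • v₀
        rw [smul_smul, ← op_mul, mul_inv_cancel_left]
        exact x.2
      · exact Subtype.ext (inv_mul_cancel_left x₁ x.1)
      · exact Subtype.ext (Subtype.ext (mul_inv_cancel_left x₁ x.1.1))
    · have : IsEmpty {x : X // f x = v} :=
        ⟨fun x => h ((hπ _ _).2 ⟨x.1.1, x.1.2, x.2.symm⟩)⟩
      rw [Nat.card_of_isEmpty]
  calc Nat.card X * Nat.card (T.fixedBy Y)
      = ∑ t : T.carrier, if t ∈ T.fixedBy Y then Nat.card X else 0 := by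
        rw [← Finset.sum_filter, Finset.sum_const, smul_eq_mul, mul_comm,
          ← Fintype.card_subtype, ← Nat.card_eq_fintype_card]
    _ = ∑ t : T.carrier, ∑ v : V.carrier, if t = π v then
          if π v ∈ T.fixedBy Y then Nat.card (X ⊓ V.rightStabilizer v : Subgroup G) else 0
          else 0 := by
        refine Finset.sum_congr rfl fun t _ => ?_
        split_ifs with ht
        · rw [← hfib t]
          refine Finset.sum_congr rfl fun v _ => ?_
          split_ifs with h
          · rfl
          · exact absurd (h ▸ ht) ‹_›
          · rfl
        · symm
          refine Finset.sum_eq_zero fun v _ => ?_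
          split_ifs with h
          · exact absurd (h ▸ ‹π v ∈ T.fixedBy Y›) ht
          · rfl
          · rfl
    _ = _ := by
        rw [Finset.sum_comm]
        refine Finset.sum_congr rfl fun v _ => ?_
        rw [Finset.sum_ite_eq' Finset.univ, if_pos (Finset.mem_univ _)]
        simp only [hfix]

variable {V}

/-- Each `z ∈ Z` moves `v` as some `y ∈ Y` does, and the action of `y` commutes with the right
action, so it preserves stabilizers. -/
theorem Linked.normal {Y : Subgroup H} {v : V.carrier} {Z : Subgroup G} (h : V.Linked Y v Z) :
    ((V.rightStabilizer v).subgroupOf Z).Normal := by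
  refine ⟨fun n hn z => ?_⟩
  obtain ⟨y, -, hy⟩ := h.2 z z.2
  have hn' : op n.1 • v = v := hn
  change op (z.1 * n.1 * z.1⁻¹) • v = v
  rw [op_mul, op_mul, mul_smul, mul_smul, ← hy, ← smul_comm y, hn', hy, smul_smul, ← op_mul,
    mul_inv_cancel, op_one, one_smul]

/-- The elements of `Y` realise every coset of the stabilizer of `v` in `Z`; so `X` can imitate all
of `Y` exactly when it meets every coset. -/
theorem Linked.forall_exists_iff_sup_subgroupOf {Y : Subgroup H} {v : V.carrier}
    {Z X : Subgroup G} (h : V.Linked Y v Z) (hX : X ≤ Z) :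
    (∀ y ∈ Y, ∃ x ∈ X, y • v = op x • v) ↔
      X.subgroupOf Z ⊔ (V.rightStabilizer v).subgroupOf Z = ⊤ := by
  have hN := h.normal
  constructor
  · refine fun hXY => top_le_iff.1 fun z _ => ?_
    obtain ⟨y, hy, hyz⟩ := h.2 z z.2
    obtain ⟨x, hx, hyx⟩ := hXY y hy
    have hzx : z * (⟨x, hX hx⟩ : Z)⁻¹ ∈ (V.rightStabilizer v).subgroupOf Z := by
      change op (z.1 * x⁻¹) • v = v
      rw [op_mul, mul_smul, ← hyz, hyx, smul_smul, ← op_mul, mul_inv_cancel, op_one, one_smul]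
    rw [sup_comm, ← inv_mul_cancel_right z ⟨x, hX hx⟩]
    exact Subgroup.mul_mem_sup hzx hx
  · intro hXN y hy
    obtain ⟨z, hz, hyz⟩ := h.1 y hy
    obtain ⟨n, hn, x, hx, hnx⟩ := Subgroup.mem_sup_of_normal_left.1
      (sup_comm (X.subgroupOf Z) _ ▸ hXN ▸ Subgroup.mem_top (⟨z, hz⟩ : Z) :
        (⟨z, hz⟩ : Z) ∈ (V.rightStabilizer v).subgroupOf Z ⊔ X.subgroupOf Z)
    refine ⟨x, hx, ?_⟩
    have hn' : op n.1 • v = v := hn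
    have hz' : z = n.1 * x.1 := (congrArg Subtype.val hnx).symm
    rw [hyz, hz', op_mul, mul_smul, hn']

theorem Linked.forall_exists_iff {Y : Subgroup H} {v : V.carrier} {Z X : Subgroup G}
    (h : V.Linked Y v Z) (hX : X ≤ Z) :
    (∀ y ∈ Y, ∃ x ∈ X, y • v = op x • v) ↔ X ⊔ (V.rightStabilizer v ⊓ Z) = Z := by
  rw [h.forall_exists_iff_sup_subgroupOf hX, ← Subgroup.inf_subgroupOf_right (V.rightStabilizer v),
    ← Subgroup.subgroupOf_sup hX inf_le_right, Subgroup.subgroupOf_eq_top]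
  exact ⟨fun h => le_antisymm (sup_le hX inf_le_right) h, fun h => h.ge⟩

/-- `X` and `Z` have the same image modulo the stabilizer, so the stabilizer has the same relative
index in both. -/
theorem Linked.card_mul_card_inf [Finite G] {Y : Subgroup H} {v : V.carrier} {Z X : Subgroup G}
    (h : V.Linked Y v Z) (hX : X ≤ Z) (hXY : ∀ y ∈ Y, ∃ x ∈ X, y • v = op x • v) :
    Nat.card (X ⊓ V.rightStabilizer v : Subgroup G) * Nat.card Z =
      Nat.card X * Nat.card (Z ⊓ V.rightStabilizer v : Subgroup G) := by
  have hN := h.normal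
  have hcard (W : Subgroup G) : Nat.card (W ⊓ V.rightStabilizer v : Subgroup G) *
      (V.rightStabilizer v).relIndex W = Nat.card W := by
    rw [inf_comm, ← Subgroup.subgroupOf_map_subtype,
      Subgroup.card_map_of_injective W.subtype_injective]
    exact Subgroup.card_mul_index _
  have hrel : (V.rightStabilizer v).relIndex X = (V.rightStabilizer v).relIndex Z := by
    rw [← Subgroup.relIndex_subgroupOf hX, ← Subgroup.relIndex_sup_right,
      (h.forall_exists_iff_sup_subgroupOf hX).1 hXY, Subgroup.relIndex_top_right]
    rfl
  rw [← hcard Z, ← hcard X, hrel]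
  ring

end FinBiset

namespace Burnside

variable {F : Type v} [Field F] {G H : Type u} [Group G] [Group H]

theorem map_cls (V : FinBiset H G) (X : FinGSet G) : map F V (cls F X) = cls F (V.tensor X) :=
  lift_cls ..

open scoped Classical in
/-- The marks of the image of a primitive idempotent under a biset. -/
theorem card_normalizer_mul_mark_map_idempotent [CharZero F] [Finite G] (V : FinBiset H G)
    (Y : Subgroup H) (Z : Subgroup G) :
    (Nat.card (Subgroup.normalizer (Z : Set G)) : F) * mark F Y (map F V (idempotent F Z)) =
      ∑ v : V.carrier with V.Linked Y v Z, (Nat.card (Z ⊓ V.rightStabilizer v : Subgroup G) : F) *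
        ((mNumber ((V.rightStabilizer v).subgroupOf Z) : ℚ) : F) := by
  have hN : (Nat.card (Subgroup.normalizer (Z : Set G)) : F) ≠ 0 :=
    Nat.cast_ne_zero.2 Nat.card_pos.ne'
  let g (v : V.carrier) (X : Subgroup G) : F :=
    if ∀ y ∈ Y, ∃ x ∈ X, y • v = op x • v then
      (Nat.card (X ⊓ V.rightStabilizer v : Subgroup G) : F) else 0
  have h1 : (Nat.card (Subgroup.normalizer (Z : Set G)) : F) *
      mark F Y (map F V (idempotent F Z)) =
      ∑ X : Subgroup G, ∑ v : V.carrier, (moebius X Z : F) * g v X := by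
    rw [idempotent, map_smul, map_smul, smul_eq_mul, mul_inv_cancel_left₀ hN, map_sum, map_sum,
      Finset.sum_filter]
    refine Finset.sum_congr rfl fun X _ => ?_
    split_ifs with h
    · rw [map_smul, map_smul, map_cls, mark_cls, smul_eq_mul, mul_comm (Nat.card X : F), mul_assoc,
        ← Nat.cast_mul, V.card_mul_card_fixedBy_tensor, Nat.cast_sum, Finset.mul_sum]
      simp only [Nat.cast_ite, Nat.cast_zero, g]
    · simp [moebius_eq_zero_of_not_le h]
  rw [h1, Finset.sum_comm, Finset.sum_filter]
  refine Finset.sum_congr rfl fun v _ => ?_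
  split_ifs with hv
  · have hZ : (Nat.card Z : F) ≠ 0 := Nat.cast_ne_zero.2 Nat.card_pos.ne'
    -- The factor `|Z|` clears the denominator in `m_{Z,N}`, so both sides become sums over `X ≤ Z`.
    refine mul_left_cancel₀ hZ ?_
    have h2 := congrArg (Rat.cast (K := F))
      (card_mul_mNumber_subgroupOf (V.rightStabilizer v) Z)
    simp only [Rat.cast_mul, Rat.cast_natCast, Rat.cast_sum, Rat.cast_intCast] at h2
    rw [mul_left_comm, h2, Finset.mul_sum, Finset.mul_sum, Finset.sum_filter]
    refine Finset.sum_congr rfl fun X _ => ?_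
    by_cases hX : X ≤ Z
    · simp only [g, ← hv.forall_exists_iff hX]
      split_ifs with hXY
      · have h3 := congrArg (Nat.cast (R := F)) (hv.card_mul_card_inf hX hXY)
        rw [Nat.cast_mul, Nat.cast_mul] at h3
        linear_combination (moebius X Z : F) * h3
      · simp
    · simp [moebius_eq_zero_of_not_le hX]
  · by_cases hY : ∀ y ∈ Y, ∃ z ∈ Z, y • v = op z • v
    -- For `v` with `Yv ⊆ vZ` that is not linked, `D` collects the `z ∈ Z` imitated by some `y ∈ Y`.
    -- It is proper, and for `X ≤ Z` the value `g v X` depends only on `X ⊓ D`, so Weisner's theorem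
    -- kills the contribution of `v`.
    · let D : Subgroup G :=
        { carrier := {z | z ∈ Z ∧ ∃ y ∈ Y, y • v = op z • v}
          one_mem' := ⟨Z.one_mem, 1, Y.one_mem, by simp⟩
          mul_mem' := by
            rintro a b ⟨ha, y, hy, h⟩ ⟨hb, y', hy', h'⟩
            refine ⟨Z.mul_mem ha hb, y * y', Y.mul_mem hy hy', ?_⟩
            rw [mul_smul, h', smul_comm, h, op_mul, mul_smul]
          inv_mem' := by
            rintro a ⟨ha, y, hy, h⟩
            refine ⟨Z.inv_mem ha, y⁻¹, Y.inv_mem hy, ?_⟩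
            rw [inv_smul_eq_iff, smul_comm, h, smul_smul, ← op_mul, mul_inv_cancel,
              op_one, one_smul] }
      have hD : D < Z := by
        refine lt_of_le_of_ne (fun z hz => hz.1) fun h => hv ⟨hY, fun z hz => ?_⟩
        rw [← h] at hz
        exact hz.2
      rw [← sum_moebius_mul_inf_eq_zero hD (g v)]
      refine Finset.sum_congr rfl fun X _ => ?_
      by_cases hX : X ≤ Z
      · have h3 : X ⊓ D ⊓ V.rightStabilizer v = X ⊓ V.rightStabilizer v := by
          refine le_antisymm (inf_le_inf_right _ inf_le_left) fun x hx => ?_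
          exact ⟨⟨hx.1, hX hx.1, 1, Y.one_mem, by rw [one_smul]; exact hx.2.symm⟩, hx.2⟩
        have h4 : (∀ y ∈ Y, ∃ x ∈ X ⊓ D, y • v = op x • v) ↔
            ∀ y ∈ Y, ∃ x ∈ X, y • v = op x • v := by
          refine forall₂_congr fun y hy => ⟨fun ⟨x, hx, h⟩ => ⟨x, hx.1, h⟩, fun ⟨x, hx, h⟩ => ?_⟩
          exact ⟨x, ⟨hx, hX hx, y, hy, h⟩, h⟩
        simp only [g, h3, h4]
      · simp [moebius_eq_zero_of_not_le hX]
    · refine Finset.sum_eq_zero fun X _ => ?_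
      by_cases hX : X ≤ Z
      · have h3 : ¬ ∀ y ∈ Y, ∃ x ∈ X, y • v = op x • v := fun h => hY fun y hy =>
          (h y hy).imp fun x hx => ⟨hX hx.1, hx.2⟩
        simp only [g, if_neg h3, mul_zero]
      · simp [moebius_eq_zero_of_not_le hX]

end Burnside

/-! ### Restriction, induction and products in terms of marks -/

namespace FinBiset

variable {G H : Type u} [Group G] [Group H]

/-- The `(H, G)`-biset `G` of restriction along `f : H → G`. -/
def restriction [Finite G] (f : H →* G) : FinBiset H G where
  carrier := G
  left := MulAction.compHom G f
  right := Monoid.toOppositeMulAction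
  comm := @SMulCommClass.mk _ _ _ (_) (_) fun h g x => (mul_assoc (f h) x g.unop).symm

/-- The `(G, H)`-biset `G` of induction along `f : H → G`. -/
def induction [Finite G] (f : H →* G) : FinBiset G H where
  carrier := G
  right :=
    { smul := fun h x => x * f h.unop
      one_smul := fun x => by
        change x * f 1 = x
        rw [map_one, mul_one]
      mul_smul := fun h h' x => by
        change x * f (h'.unop * h.unop) = x * f h'.unop * f h.unop
        rw [map_mul, mul_assoc] }
  comm := @SMulCommClass.mk _ _ _ (_) (_) fun g h x => (mul_assoc g x (f h.unop)).symm

/-- `G` acts simply transitively on the right of `V`, so every class has a unique representative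
with first component `v₀`. -/
theorem tensor_isIso_res (V : FinBiset H G) (f : H →* G) (v₀ : V.carrier)
    (hf : ∀ h : H, h • v₀ = op (f h) • v₀)
    (hb : Function.Bijective fun g : G => op g • v₀) (X : FinGSet G) :
    (X.res f).IsIso (V.tensor X) := by
  let e : X.carrier → (V.tensor X).carrier := fun x => Quotient.mk (V.tensorSetoid X) (v₀, x)
  have he : Function.Bijective e := by
    constructor
    · intro x x' h
      obtain ⟨g, hg⟩ := Quotient.exact h
      obtain ⟨h1, h2⟩ := Prod.mk.inj hg
      have hg1 : (1 : G) = g := hb.1 (by simpa using h1)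
      rw [h2, ← hg1, inv_one]
      exact (one_smul G x).symm
    · rintro ⟨⟨v, x⟩⟩
      obtain ⟨g, rfl⟩ := hb.2 v
      refine ⟨g • x, Quotient.sound ⟨g, Prod.ext rfl ?_⟩⟩
      exact (inv_smul_smul g x).symm
  refine ⟨Equiv.ofBijective e he, fun h x => ?_⟩
  refine Quotient.sound ⟨f h, Prod.ext (hf h) ?_⟩
  exact (@inv_smul_smul G X.carrier _ _ (f h) x).symm

end FinBiset

namespace Burnside

variable {F : Type v} [Field F] {G H : Type u} [Group G] [Group H]

theorem res_cls (f : H →* G) (X : FinGSet G) : res F f (cls F X) = cls F (X.res f) :=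
  lift_cls ..

theorem extProd_cls (X : FinGSet G) (Y : FinGSet H) :
    extProd F G H (cls F X) (cls F Y) = cls F (X.prod Y) := by
  rw [extProd, lift_cls, lift_cls]

theorem map_eq_res (V : FinBiset H G) (f : H →* G) (v₀ : V.carrier)
    (hf : ∀ h : H, h • v₀ = op (f h) • v₀)
    (hb : Function.Bijective fun g : G => op g • v₀) : map F V = res F f :=
  hom_ext fun X => by
    rw [map_cls, res_cls, cls_eq_of_iso (V.tensor_isIso_res f v₀ hf hb X)]

theorem mark_res (f : H →* G) (Y : Subgroup H) (x : Burnside F G) :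
    mark F Y (res F f x) = mark F (Y.map f) x := by
  have h : mark F Y ∘ₗ res F f = mark F (Y.map f) := hom_ext fun X => by
    rw [LinearMap.comp_apply, res_cls, mark_cls, mark_cls]
    refine congrArg Nat.cast (Nat.card_congr (Equiv.subtypeEquivRight fun x => ?_))
    exact ⟨fun h => by
      rintro _ ⟨y, hy, rfl⟩
      exact h y hy, fun h y hy => h _ ⟨y, hy, rfl⟩⟩
  exact LinearMap.congr_fun h x

theorem mark_extProd (Y : Subgroup (G × H)) (a : Burnside F G) (b : Burnside F H) :
    mark F Y (extProd F G H a b) =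
      mark F (Y.map (MonoidHom.fst G H)) a * mark F (Y.map (MonoidHom.snd G H)) b := by
  have h : (extProd F G H).compr₂ (mark F Y) =
      (LinearMap.mul F F).compl₁₂ (mark F (Y.map (MonoidHom.fst G H)))
        (mark F (Y.map (MonoidHom.snd G H))) := by
    refine hom_ext fun X => hom_ext fun X' => ?_
    rw [LinearMap.compr₂_apply, LinearMap.compl₁₂_apply, extProd_cls, mark_cls, mark_cls, mark_cls,
      LinearMap.mul_apply', ← Nat.cast_mul, ← Nat.card_prod]
    refine congrArg Nat.cast (Nat.card_congr ?_)
    refine Equiv.trans (Equiv.subtypeEquivRight fun x => ?_)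
      (Equiv.subtypeProdEquivProd (p := (· ∈ X.fixedBy (Y.map (MonoidHom.fst G H))))
        (q := (· ∈ X'.fixedBy (Y.map (MonoidHom.snd G H)))))
    constructor
    · refine fun h => ⟨?_, ?_⟩
      · rintro _ ⟨y, hy, rfl⟩
        exact congrArg Prod.fst (h y hy)
      · rintro _ ⟨y, hy, rfl⟩
        exact congrArg Prod.snd (h y hy)
    · exact fun h y hy => Prod.ext (h.1 _ ⟨y, hy, rfl⟩) (h.2 _ ⟨y, hy, rfl⟩)
  exact LinearMap.congr_fun₂ h a b

/-- Translation by `g⁻¹` carries the fixed points of `Y` to those of `Z`. The hypotheses have the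
shape of `Linked` for the biset `G`. -/
theorem mark_eq_of_conj {Y Z : Subgroup G} (g : G) (h₁ : ∀ y ∈ Y, ∃ z ∈ Z, y * g = g * z)
    (h₂ : ∀ z ∈ Z, ∃ y ∈ Y, y * g = g * z) (x : Burnside F G) : mark F Y x = mark F Z x := by
  refine LinearMap.congr_fun (hom_ext fun X => ?_) x
  rw [mark_cls, mark_cls]
  refine congrArg Nat.cast (Nat.card_congr
    ((MulAction.toPerm g⁻¹ : Equiv.Perm X.carrier).subtypeEquiv fun x => ⟨fun h z hz => ?_,
      fun h y hy => ?_⟩))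
  · obtain ⟨y, hy, hyz⟩ := h₂ z hz
    have hz' : z * g⁻¹ = g⁻¹ * y := by
      rw [eq_inv_mul_iff_mul_eq, ← mul_assoc, ← hyz, mul_inv_cancel_right]
    rw [MulAction.toPerm_apply, smul_smul, hz', mul_smul, h y hy]
  · obtain ⟨z, hz, hyz⟩ := h₁ y hy
    have hx := h z hz
    have hy' : y = g * (z * g⁻¹) := by
      rw [← mul_assoc, ← hyz, mul_inv_cancel_right]
    rw [MulAction.toPerm_apply, smul_smul] at hx
    rw [hy', mul_smul, hx, smul_inv_smul]

theorem exists_linked_of_mark_map_idempotent_ne_zero [CharZero F] [Finite G] {V : FinBiset H G}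
    {Y : Subgroup H} {Z : Subgroup G} (h : mark F Y (map F V (idempotent F Z)) ≠ 0) :
    ∃ v, V.Linked Y v Z ∧ mNumber ((V.rightStabilizer v).subgroupOf Z) ≠ 0 := by
  classical
  have hN : (Nat.card (Subgroup.normalizer (Z : Set G)) : F) ≠ 0 :=
    Nat.cast_ne_zero.2 Nat.card_pos.ne'
  have h' := mul_ne_zero hN h
  rw [card_normalizer_mul_mark_map_idempotent] at h'
  obtain ⟨v, hv, hv'⟩ := Finset.exists_ne_zero_of_sum_ne_zero h'
  exact ⟨v, by simpa using hv, Rat.cast_ne_zero.1 (right_ne_zero_of_mul hv')⟩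

/-- With a constant right stabilizer all summands of the mark formula are equal, so no cancellation
can occur. -/
theorem mark_map_idempotent_ne_zero [CharZero F] [Finite G] {V : FinBiset H G}
    {Y : Subgroup H} {Z N : Subgroup G} (hN : ∀ v, V.rightStabilizer v = N)
    (hm : mNumber (N.subgroupOf Z) ≠ 0) {v : V.carrier} (hv : V.Linked Y v Z) :
    mark F Y (map F V (idempotent F Z)) ≠ 0 := by
  classical
  refine right_ne_zero_of_mul (a := (Nat.card (Subgroup.normalizer (Z : Set G)) : F)) ?_
  rw [card_normalizer_mul_mark_map_idempotent]
  simp only [hN]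
  rw [Finset.sum_const, ← Nat.cast_smul_eq_nsmul F]
  refine smul_ne_zero (Nat.cast_ne_zero.2 ?_)
    (mul_ne_zero (Nat.cast_ne_zero.2 Nat.card_pos.ne') (Rat.cast_ne_zero.2 hm))
  exact Finset.card_ne_zero.2 ⟨v, by simpa using hv⟩

/-- The identity biset makes the mark formula applicable to the idempotents themselves. -/
theorem map_restriction_id [Finite G] :
    map F (FinBiset.restriction (MonoidHom.id G)) = (LinearMap.id : Burnside F G →ₗ[F] _) := by
  rw [map_eq_res (FinBiset.restriction (MonoidHom.id G)) (MonoidHom.id G) (1 : G)]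
  · exact hom_ext fun X => res_cls _ _
  · exact fun h => (mul_one h).trans (one_mul h).symm
  · exact (Equiv.mulLeft (1 : G)).bijective

theorem mark_idempotent_self_ne_zero [CharZero F] [Finite G] (Z : Subgroup G) :
    mark F Z (idempotent F Z) ≠ 0 := by
  have h := mark_map_idempotent_ne_zero (F := F) (V := FinBiset.restriction (MonoidHom.id G))
    (Y := Z) (Z := Z) (N := ⊥) ?_ ?_ (v := (1 : G)) ?_
  · rwa [map_restriction_id] at h
  · refine fun v => (Subgroup.eq_bot_iff_forall _).2 fun g hg => ?_
    exact (@mul_eq_left G _ _ v g).1 hg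
  · rw [Subgroup.bot_subgroupOf, mNumber_bot]
    exact one_ne_zero
  · exact ⟨fun y hy => ⟨y, hy, (mul_one y).trans (one_mul y).symm⟩,
      fun y hy => ⟨y, hy, (mul_one y).trans (one_mul y).symm⟩⟩

theorem mark_eq_of_mark_idempotent_ne_zero [CharZero F] [Finite G] {Y Z : Subgroup G}
    (h : mark F Y (idempotent F Z) ≠ 0) (x : Burnside F G) : mark F Y x = mark F Z x := by
  have h' : mark F Y (map F (FinBiset.restriction (MonoidHom.id G)) (idempotent F Z)) ≠ 0 := by
    rwa [map_restriction_id]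
  obtain ⟨v, hv, -⟩ := exists_linked_of_mark_map_idempotent_ne_zero h'
  exact mark_eq_of_conj (G := G) v hv.1 hv.2 x

end Burnside

namespace ShiftedBurnside

variable {F : Type v} [Field F] {K : Type u} [Group K] {G H : Type u} [Group G] [Group H]

theorem mark_map_restriction [Finite K] [Finite G] (f : H →* G) (Y : Subgroup (H × K))
    (x : ShiftedBurnside F K G) :
    Burnside.mark F Y (map F K (FinBiset.restriction f) x) =
      Burnside.mark F (Y.map (f.prodMap (MonoidHom.id K))) x := by
  rw [map, Burnside.map_eq_res _ (f.prodMap (MonoidHom.id K)) ((1, 1) : G × K),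
    Burnside.mark_res]
  · exact fun h => Prod.ext ((mul_one (f h.1)).trans (one_mul (f h.1)).symm)
      ((mul_one h.2).trans (one_mul h.2).symm)
  · exact (Equiv.mulLeft (1 : G × K)).bijective

theorem mark_mul (Y : Subgroup ((G × H) × K)) (a : ShiftedBurnside F K G)
    (b : ShiftedBurnside F K H) :
    Burnside.mark F Y (mul F K a b) =
      Burnside.mark F (Y.map ((MonoidHom.fst G H).prodMap (MonoidHom.id K))) a *
        Burnside.mark F (Y.map ((MonoidHom.snd G H).prodMap (MonoidHom.id K))) b := by
  rw [mul, Burnside.mark_res, Burnside.mark_extProd, Subgroup.map_map, Subgroup.map_map]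
  rfl

end ShiftedBurnside

end Marks

/-! ### Idempotents contained in an ideal -/

namespace GreenIdeal

variable {F : Type v} [Field F] [CharZero F] {K : Type u} [Group K] [Finite K]

/-- Restricting the external product along the diagonal of `G` gives the internal product of the
Burnside algebra, in which `e_Y · x` is the mark of `x` at `Y` times `e_Y`. -/
theorem idempotent_mem_of_mark_ne_zero (I : GreenIdeal F K) {G : Type u} [Group G] [Finite G]
    {x : ShiftedBurnside F K G} (hx : x ∈ I.obj G) {Y : Subgroup (G × K)}
    (hY : Burnside.mark F Y x ≠ 0) : idempotent F Y ∈ I.obj G := by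
  let d : G →* G × G := (MonoidHom.id G).prod (MonoidHom.id G)
  have hp := I.map_mem _ _ (FinBiset.restriction d) _ (I.mul_mem G G (idempotent F Y) x hx)
  have heq : ShiftedBurnside.map F K (FinBiset.restriction d)
      (ShiftedBurnside.mul F K (idempotent F Y) x) = Burnside.mark F Y x • idempotent F Y := by
    refine Burnside.eq_of_mark_eq fun W => ?_
    rw [ShiftedBurnside.mark_map_restriction, ShiftedBurnside.mark_mul, Subgroup.map_map,
      Subgroup.map_map, map_smul, smul_eq_mul]
    have h1 : ((MonoidHom.fst G G).prodMap (MonoidHom.id K)).comp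
        (d.prodMap (MonoidHom.id K)) = MonoidHom.id (G × K) := rfl
    have h2 : ((MonoidHom.snd G G).prodMap (MonoidHom.id K)).comp
        (d.prodMap (MonoidHom.id K)) = MonoidHom.id (G × K) := rfl
    rw [h1, h2, Subgroup.map_id]
    by_cases hW : Burnside.mark F W (idempotent F Y) = 0
    · rw [hW, zero_mul, mul_zero]
    · rw [Burnside.mark_eq_of_mark_idempotent_ne_zero hW x, mul_comm]
  rw [heq] at hp
  exact (Submodule.smul_mem_iff _ hY).1 hp

theorem mem_of_idempotent_mem (I : GreenIdeal F K) {G : Type u} [Group G] [Finite G]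
    {x : ShiftedBurnside F K G}
    (h : ∀ Y : Subgroup (G × K), Burnside.mark F Y x ≠ 0 → idempotent F Y ∈ I.obj G) :
    x ∈ I.obj G := by
  rw [Burnside.eq_sum_mark_smul_idempotent x]
  refine Submodule.sum_mem _ fun Y _ => ?_
  by_cases hY : Burnside.mark F Y x = 0
  · rw [hY, mul_zero, zero_smul]
    exact Submodule.zero_mem _
  · exact Submodule.smul_mem _ _ (h Y hY)

/-- The induction biset times `K` has all its right stabilizers equal to the kernel of `f × id`, and
`(1, 1)` links `Z` to its image; so the image of `e_Z` has a nonzero mark there. -/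
theorem idempotent_map_mem (I : GreenIdeal F K) {A B : Type u} [Group A] [Finite A] [Group B]
    [Finite B] (f : A →* B) {Z : Subgroup (A × K)} (hZ : idempotent F Z ∈ I.obj A)
    (hm : mNumber ((f.prodMap (MonoidHom.id K)).ker.subgroupOf Z) ≠ 0) :
    idempotent F (Z.map (f.prodMap (MonoidHom.id K))) ∈ I.obj B := by
  refine I.idempotent_mem_of_mark_ne_zero (I.map_mem A B (FinBiset.induction f) _ hZ) ?_
  refine Burnside.mark_map_idempotent_ne_zero (V := (FinBiset.induction f).prodGroup K)
    (v := ((1, 1) : B × K)) (fun v => ?_) hm ⟨?_, ?_⟩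
  · ext g
    refine Iff.trans ?_ (MonoidHom.mem_ker (f := f.prodMap (MonoidHom.id K))).symm
    constructor
    · intro h
      obtain ⟨h1, h2⟩ := Prod.mk.inj h
      exact Prod.ext ((@mul_eq_left B _ _ v.1 (f g.1)).1 h1)
        ((@mul_eq_left K _ _ v.2 g.2).1 h2)
    · intro h
      obtain ⟨h1, h2⟩ := Prod.mk.inj h
      exact Prod.ext ((@mul_eq_left B _ _ v.1 (f g.1)).2 h1)
        ((@mul_eq_left K _ _ v.2 g.2).2 h2)
  · rintro _ ⟨z, hz, rfl⟩
    exact ⟨z, hz, Prod.ext ((mul_one (f z.1)).trans (one_mul (f z.1)).symm)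
      ((mul_one z.2).trans (one_mul z.2).symm)⟩
  · exact fun z hz => ⟨_, ⟨z, hz, rfl⟩, Prod.ext ((mul_one (f z.1)).trans (one_mul (f z.1)).symm)
      ((mul_one z.2).trans (one_mul z.2).symm)⟩

end GreenIdeal

/-! ### The ideal generated by a group over `K` -/

namespace GrpOver

variable {F : Type v} [Field F] {K : Type u} [Group K] [Finite K]

theorem ideal_le_iff {X : GrpOver K} {I : GreenIdeal F K} :
    X.ideal F ≤ I ↔ idempotent F X.hom.graph ∈ I.obj X.carrier := by
  constructor
  · intro h
    refine h X.carrier ?_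
    exact (Submodule.mem_iInf _).2 fun J => (Submodule.mem_iInf _).2 fun hJ => hJ
  · intro h
    exact (GreenIdeal.isGLB_sInf _).1 h

variable [CharZero F]

theorem HasQuotient.ideal_le {X Y : GrpOver K} (h : X.HasQuotient Y) :
    X.ideal F ≤ Y.ideal F := by
  rw [ideal_le_iff]
  obtain ⟨f, hf⟩ := h
  obtain ⟨k, hk⟩ := f.2
  refine (Y.ideal F).idempotent_mem_of_mark_ne_zero ((Y.ideal F).map_mem _ _
    (FinBiset.restriction f.1) _ (ideal_le_iff.1 le_rfl)) ?_
  have hk' (x : X.carrier) : k * X.hom x = Y.hom (f.1 x) * k := by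
    rw [← hk, MulAut.conj_apply, inv_mul_cancel_right]
  have hconj (x : X.carrier) : X.hom x * k⁻¹ = k⁻¹ * Y.hom (f.1 x) := by
    rw [eq_inv_mul_iff_mul_eq, ← mul_assoc, hk', mul_inv_cancel_right]
  -- The graph of `X` maps onto the graph of `Y` only up to the inner automorphism in the definition
  -- of a morphism; conjugation by `(1, k⁻¹)` absorbs it.
  rw [ShiftedBurnside.mark_map_restriction,
    Burnside.mark_eq_of_conj (Z := Y.hom.graph) ((1, k⁻¹) : Y.carrier × K)]
  · exact Burnside.mark_idempotent_self_ne_zero _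
  · rintro _ ⟨⟨x, k'⟩, hx, rfl⟩
    obtain rfl : X.hom x = k' := hx
    exact ⟨(f.1 x, Y.hom (f.1 x)), rfl,
      Prod.ext ((mul_one (f.1 x)).trans (one_mul _).symm) (hconj x)⟩
  · rintro ⟨y, k'⟩ hy
    obtain rfl : Y.hom y = k' := hy
    obtain ⟨x, rfl⟩ := hf y
    exact ⟨_, ⟨(x, X.hom x), rfl, rfl⟩,
      Prod.ext ((mul_one (f.1 x)).trans (one_mul _).symm) (hconj x)⟩

/-- The group over `K` given by a subgroup of `G × K`. -/
def ofSubgroup {G : Type u} [Group G] [Finite G] (Y : Subgroup (G × K)) : GrpOver K where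
  carrier := Y
  hom := (MonoidHom.snd G K).comp Y.subtype

/-- The first projection of a subgroup of `G × K`. -/
def ofSubgroupFst {G : Type u} [Group G] [Finite G] (Y : Subgroup (G × K)) :
    (ofSubgroup Y).carrier →* G :=
  (MonoidHom.fst G K).comp Y.subtype

theorem map_graph_ofSubgroup {G : Type u} [Group G] [Finite G] (Y : Subgroup (G × K)) :
    (ofSubgroup Y).hom.graph.map ((ofSubgroupFst Y).prodMap (MonoidHom.id K)) = Y := by
  ext y
  constructor
  · rintro ⟨⟨z, k⟩, hz, rfl⟩
    obtain rfl : (ofSubgroup Y).hom z = k := hz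
    exact z.2
  · intro hy
    exact ⟨((⟨y, hy⟩ : Y), y.2), rfl, rfl⟩

/-- A group over `K` is isomorphic to the graph of its structure map. -/
noncomputable def graphEquiv (X : GrpOver K) : X.carrier ≃* X.hom.graph :=
  MulEquiv.ofBijective
    (((MonoidHom.id X.carrier).prod X.hom).codRestrict X.hom.graph fun _ => rfl)
    ⟨fun _ _ h => (Prod.mk.inj (Subtype.ext_iff.1 h)).1,
      fun ⟨⟨x, _⟩, hx⟩ => ⟨x, Subtype.ext (Prod.ext rfl hx)⟩⟩

theorem hasQuotient_ofSubgroup_graph (X : GrpOver K) :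
    X.HasQuotient (ofSubgroup X.hom.graph) :=
  ⟨⟨X.graphEquiv.toMonoidHom, 1, fun x => by
    rw [map_one]
    rfl⟩, X.graphEquiv.surjective⟩

theorem ofSubgroup_graph_hasQuotient (X : GrpOver K) :
    (ofSubgroup X.hom.graph).HasQuotient X :=
  ⟨⟨ofSubgroupFst X.hom.graph, 1, fun x => by
    rw [map_one]
    exact x.2.symm⟩, fun x => ⟨X.graphEquiv x, rfl⟩⟩

/-- The projection `Y → G` transports idempotents both ways: induction takes the graph of `Y → K`
back to `Y`, and restriction of `e_Y` has a nonzero mark at that graph. -/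
theorem ideal_ofSubgroup_le_iff {G : Type u} [Group G] [Finite G] (Y : Subgroup (G × K))
    (I : GreenIdeal F K) : (ofSubgroup Y).ideal F ≤ I ↔ idempotent F Y ∈ I.obj G := by
  rw [ideal_le_iff]
  constructor
  · intro h
    have h' := I.idempotent_map_mem (ofSubgroupFst Y) h ?_
    · rwa [map_graph_ofSubgroup] at h'
    -- A graph element killed by the projection has trivial components in both `G` and `K`, hence is
    -- trivial.
    · have hbot : ((ofSubgroupFst Y).prodMap (MonoidHom.id K)).ker.subgroupOf
          (ofSubgroup Y).hom.graph = ⊥ := by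
        refine (Subgroup.eq_bot_iff_forall _).2 ?_
        rintro ⟨⟨y, k⟩, hyk⟩ hy
        obtain ⟨h1, h2⟩ := Prod.mk.inj hy
        have hy1 : y = 1 := Subtype.ext (Prod.ext h1 (hyk.trans h2))
        exact Subtype.ext (Prod.ext hy1 h2)
      rw [hbot, mNumber_bot]
      exact one_ne_zero
  · intro h
    refine I.idempotent_mem_of_mark_ne_zero
      (I.map_mem _ _ (FinBiset.restriction (ofSubgroupFst Y)) _ h) ?_
    rw [ShiftedBurnside.mark_map_restriction, map_graph_ofSubgroup]
    exact Burnside.mark_idempotent_self_ne_zero _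

theorem ideal_quotient_le {X : GrpOver K} (N : Subgroup X.carrier) [N.Normal]
    (hN : N ≤ X.hom.ker) (hm : mNumber N ≠ 0) : (X.quotient N hN).ideal F ≤ X.ideal F := by
  let f : X.carrier →* (X.quotient N hN).carrier := QuotientGroup.mk' N
  have h := (X.ideal F).idempotent_map_mem f (ideal_le_iff.1 le_rfl) ?_
  · rw [ideal_le_iff]
    convert h
    ext ⟨x, k⟩
    constructor
    · intro hx
      obtain ⟨x, rfl⟩ := QuotientGroup.mk'_surjective N x
      exact ⟨(x, k), hx, rfl⟩
    · rintro ⟨⟨x, k'⟩, hx, h⟩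
      obtain ⟨rfl, rfl⟩ := Prod.mk.inj h
      exact hx
  · rw [← mNumber_map_equiv X.graphEquiv] at hm
    convert hm
    ext ⟨⟨x, k⟩, hx⟩
    constructor
    · intro hx'
      obtain ⟨h1, h2⟩ := Prod.mk.inj hx'
      exact ⟨x, (QuotientGroup.eq_one_iff x).1 h1, Subtype.ext (Prod.ext rfl hx)⟩
    · rintro ⟨y, hy, h⟩
      obtain ⟨rfl, h2⟩ := Prod.mk.inj (Subtype.ext_iff.1 h)
      refine Prod.ext ((QuotientGroup.eq_one_iff y).2 hy) ?_
      exact h2.symm.trans (hN hy)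

-- A group that is not a `B_K`-group has a nontrivial `N` with `m_{X,N} ≠ 0`. Its quotient by `N` is
-- smaller and has the same ideal: one inclusion holds for any quotient, the other because this
-- number is nonzero.
variable (F) in
theorem exists_isBGroup (X : GrpOver K) :
    ∃ Y : GrpOver K, Y.IsBGroup ∧ X.HasQuotient Y ∧ X.ideal F = Y.ideal F := by
  induction hn : Nat.card X.carrier using Nat.strong_induction_on generalizing X with
  | _ n ih =>
    by_cases hX : X.IsBGroup
    · exact ⟨X, hX, HasQuotient.refl X, rfl⟩
    · simp only [IsBGroup, not_forall] at hX
      obtain ⟨N, hN, hne, hk, hm⟩ := hX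
      have hlt : Nat.card (X.quotient N hk).carrier < n := by
        rw [← hn, N.card_eq_card_quotient_mul_card_subgroup]
        exact lt_mul_of_one_lt_right Nat.card_pos ((Subgroup.one_lt_card_iff_ne_bot N).2 hne)
      obtain ⟨Y, hY, hq, he⟩ := ih _ hlt _ rfl
      have hXq := X.hasQuotient_quotient N hk
      exact ⟨Y, hY, hXq.trans hq, (le_antisymm hXq.ideal_le (ideal_quotient_le N hk hm)).trans he⟩

variable (F) in
theorem exists_mem_isBGroup {S : Set (GrpOver K)} (hS : IsRepresentativeSet S) (X : GrpOver K) :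
    ∃ Y : BGroups S, X.ideal F = Y.1.ideal F := by
  obtain ⟨Y, hY, -, he⟩ := exists_isBGroup F X
  obtain ⟨Z, ⟨hZ, ⟨i⟩⟩, -⟩ := hS Y
  exact ⟨⟨Z, hZ, hY.of_iso i⟩, he.trans
    (le_antisymm (HasQuotient.of_iso i).ideal_le (HasQuotient.of_iso i.symm).ideal_le)⟩

/-- Ideals are determined by the `B_K`-groups whose ideals they contain. -/
theorem le_of_forall_ideal_le {S : Set (GrpOver K)} (hS : IsRepresentativeSet S)
    {I J : GreenIdeal F K} (h : ∀ X : BGroups S, X.1.ideal F ≤ I → X.1.ideal F ≤ J) : I ≤ J := by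
  intro G _ _ x hx
  refine J.mem_of_idempotent_mem fun Y hY => ?_
  obtain ⟨X, hX⟩ := exists_mem_isBGroup F hS (ofSubgroup Y)
  rw [← ideal_ofSubgroup_le_iff, hX]
  refine h X ?_
  rw [← hX, ideal_ofSubgroup_le_iff]
  exact I.idempotent_mem_of_mark_ne_zero hx hY

/-- A linked point makes the quotient of `Z` by the stabilizer a quotient of `Y`; the nonvanishing
of `m` lets a surjection from `Z` onto `L` be chosen to factor through it. -/
theorem hasQuotient_of_linked {G H : Type u} [Group G] [Finite G] [Group H] [Finite H]
    {U : FinBiset H G} {Y : Subgroup (H × K)} {Z : Subgroup (G × K)}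
    {v : (U.prodGroup K).carrier} (hv : (U.prodGroup K).Linked Y v Z)
    (hm : mNumber (((U.prodGroup K).rightStabilizer v).subgroupOf Z) ≠ 0) {L : GrpOver K}
    (hL : L.IsBGroup) (hZ : (ofSubgroup Z).HasQuotient L) : (ofSubgroup Y).HasQuotient L := by
  -- `K` acts freely on the second component of `U × K`, so an element fixing `v` has trivial
  -- `K`-component.
  have hker : ((U.prodGroup K).rightStabilizer v).subgroupOf Z ≤ (ofSubgroup Z).hom.ker := by
    intro z hz
    exact (@mul_eq_left K _ _ v.2 z.1.2).1 (Prod.mk.inj hz).2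
  obtain ⟨f, hf, hNf⟩ := exists_hom_of_mNumber_ne_zero hL _ (ofSubgroup Z) rfl hZ _
    hv.normal hker hm
  obtain ⟨k, hk⟩ := f.2
  have hex (y : Y) : ∃ z : Z, y.1 • v = op z.1 • v := by
    obtain ⟨z, hz, h⟩ := hv.1 y y.2
    exact ⟨⟨z, hz⟩, h⟩
  choose t ht using hex
  let f' : Z →* L.carrier := f.1
  -- Two choices of `z` for the same `y` differ by an element of the stabilizer, which `f'` kills.
  have hft (y : Y) (z : Z) (h : y.1 • v = op z.1 • v) : f' (t y) = f' z := by
    have hmem : t y * z⁻¹ ∈ f'.ker := by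
      refine hNf ?_
      change op ((t y).1 * z.1⁻¹) • v = v
      rw [op_mul, mul_smul, ← ht, h, smul_smul, ← op_mul, mul_inv_cancel, op_one, one_smul]
    rwa [MonoidHom.mem_ker, map_mul, map_inv, mul_inv_eq_one] at hmem
  let g : Y →* L.carrier := MonoidHom.mk' (fun y => f' (t y)) fun y y' => by
    rw [← map_mul]
    refine hft _ _ ?_
    rw [Subgroup.coe_mul, Subgroup.coe_mul, mul_smul, ht y', smul_comm, ht y, op_mul, mul_smul]
  -- Linking at `v` conjugates the `K`-components by `w`, which corrects the inner automorphism of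
  -- the new morphism.
  let w : K := v.2
  refine ⟨⟨g, k * w⁻¹, fun y => ?_⟩, fun l => ?_⟩
  · have h : y.1.2 * w = w * (t y).1.2 := (Prod.mk.inj (ht y)).2
    rw [map_mul, MulAut.mul_apply]
    refine Eq.trans (congrArg _ ?_) (hk (t y))
    rw [MulAut.conj_apply, inv_inv]
    exact (mul_assoc _ _ _).trans (inv_mul_eq_of_eq_mul h)
  · obtain ⟨z, rfl⟩ := hf l
    obtain ⟨y, hy, h⟩ := hv.2 z.1 z.2
    exact ⟨⟨y, hy⟩, hft ⟨y, hy⟩ z h⟩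

end GrpOver

/-! ### Ideals defined by the vanishing of marks -/

namespace GreenIdeal

variable {F : Type v} [Field F] [CharZero F] {K : Type u} [Group K] [Finite K]

/-- The ideal of the elements whose marks vanish at the subgroups having no quotient in a set
of `B_K`-groups. -/
noncomputable def ofBGroups (F : Type v) [Field F] [CharZero F] (T : Set (GrpOver K))
    (hT : ∀ L ∈ T, L.IsBGroup) : GreenIdeal F K where
  obj G _ _ := ⨅ (Y : Subgroup (G × K)) (_ : ∀ L ∈ T, ¬ (GrpOver.ofSubgroup Y).HasQuotient L),
    LinearMap.ker (Burnside.mark F Y)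
  map_mem G H _ _ _ _ U x hx := by
    simp only [Submodule.mem_iInf, LinearMap.mem_ker] at hx ⊢
    intro Y hY
    -- Only the `e_Z` with `Z` having a quotient in `T` occur in `x`; a nonzero mark of the image of
    -- such an `e_Z` at `Y` would pass that quotient on to `Y`.
    rw [Burnside.eq_sum_mark_smul_idempotent x, map_sum, map_sum]
    refine Finset.sum_eq_zero fun Z _ => ?_
    rw [map_smul, map_smul, smul_eq_mul]
    by_cases hZ : Burnside.mark F Z x = 0
    · rw [hZ, mul_zero, zero_mul]
    · have hZ' : ∃ L ∈ T, (GrpOver.ofSubgroup Z).HasQuotient L := by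
        by_contra! h
        exact hZ (hx Z h)
      obtain ⟨L, hL, hZL⟩ := hZ'
      by_contra hne
      obtain ⟨v, hv, hm⟩ :=
        Burnside.exists_linked_of_mark_map_idempotent_ne_zero (right_ne_zero_of_mul hne)
      exact hY L hL (GrpOver.hasQuotient_of_linked hv hm (hT L hL) hZL)
  mul_mem G H _ _ _ _ a b hb := by
    simp only [Submodule.mem_iInf, LinearMap.mem_ker] at hb ⊢
    intro Y hY
    rw [ShiftedBurnside.mark_mul, hb, mul_zero]
    -- The mark of `b` is taken at the image of `Y` in `H × K`, a quotient of `Y` over `K`, so a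
    -- quotient in `T` of the image would also be one of `Y`.
    intro L hL hq
    refine hY L hL (GrpOver.HasQuotient.trans ⟨⟨?_, 1, ?_⟩, ?_⟩ hq)
    · exact ((MonoidHom.snd G H).prodMap (MonoidHom.id K)).subgroupMap Y
    · intro y
      rw [map_one]
      rfl
    · exact MonoidHom.subgroupMap_surjective _ _

theorem ideal_le_ofBGroups {T : Set (GrpOver K)} (hT : ∀ L ∈ T, L.IsBGroup) {L : GrpOver K}
    (hL : L ∈ T) : L.ideal F ≤ ofBGroups F T hT := by
  rw [GrpOver.ideal_le_iff]
  simp only [ofBGroups, Submodule.mem_iInf, LinearMap.mem_ker]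
  intro Y hY
  by_contra hne
  have hid : (MonoidHom.id L.carrier).prodMap (MonoidHom.id K) =
    MonoidHom.id (L.carrier × K) := rfl
  have hne' : Burnside.mark F Y (ShiftedBurnside.map F K
      (FinBiset.restriction (MonoidHom.id L.carrier)) (idempotent F L.hom.graph)) ≠ 0 := by
    rwa [ShiftedBurnside.mark_map_restriction, hid, Subgroup.map_id]
  obtain ⟨v, hv, hm⟩ := Burnside.exists_linked_of_mark_map_idempotent_ne_zero hne'
  exact hY L hL (GrpOver.hasQuotient_of_linked hv hm (hT L hL) L.ofSubgroup_graph_hasQuotient)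

/-- The generating idempotent has a nonzero mark at its own graph, so that graph cannot be among the
subgroups where marks must vanish. -/
theorem exists_hasQuotient_of_ideal_le_ofBGroups {T : Set (GrpOver K)}
    (hT : ∀ L ∈ T, L.IsBGroup) {X : GrpOver K} (hX : X.ideal F ≤ ofBGroups F T hT) :
    ∃ L ∈ T, X.HasQuotient L := by
  rw [GrpOver.ideal_le_iff] at hX
  simp only [ofBGroups, Submodule.mem_iInf, LinearMap.mem_ker] at hX
  by_contra! h
  exact Burnside.mark_idempotent_self_ne_zero (F := F) X.hom.graph
    (hX _ fun L hL hq => h L hL (X.hasQuotient_ofSubgroup_graph.trans hq))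

end GreenIdeal

/-! ### The lattice isomorphism and complete distributivity -/

namespace GrpOver

variable (F : Type v) [Field F] [CharZero F] {K : Type u} [Group K] [Finite K]
  {S : Set (GrpOver K)}

theorem setOf_ideal_le_mem_closedSubsets (I : GreenIdeal F K) :
    {X : BGroups S | X.1.ideal F ≤ I} ∈ closedSubsets S :=
  fun _ hX _ h => (HasQuotient.ideal_le h).trans hX

/-- The sum lies in `ofBGroups` of `P`, so a `B_K`-group whose ideal it contains has a quotient in
`P`, and closedness puts it in `P`. -/
theorem ideal_le_iSup_iff (P : closedSubsets S) (X : BGroups S) :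
    X.1.ideal F ≤ ⨆ Y ∈ (P : Set (BGroups S)), Y.1.ideal F ↔ X ∈ (P : Set (BGroups S)) := by
  constructor
  · intro h
    let T : Set (GrpOver K) := Subtype.val '' (P : Set (BGroups S))
    have hT : ∀ L ∈ T, L.IsBGroup := by
      rintro _ ⟨L, -, rfl⟩
      exact L.2.2
    obtain ⟨_, ⟨L, hL, rfl⟩, hq⟩ := GreenIdeal.exists_hasQuotient_of_ideal_le_ofBGroups (F := F) hT
      (h.trans (iSup₂_le fun L hL => GreenIdeal.ideal_le_ofBGroups hT ⟨L, hL, rfl⟩))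
    exact P.2 L hL X hq
  · exact fun h => le_iSup₂_of_le X h le_rfl

/-- The isomorphism between the lattice of ideals of `𝔽B_K` and the lattice of closed sets of
`B_K`-groups. -/
noncomputable def idealOrderIso (hS : IsRepresentativeSet S) :
    GreenIdeal F K ≃o closedSubsets S where
  toFun I := ⟨{X | X.1.ideal F ≤ I}, setOf_ideal_le_mem_closedSubsets F I⟩
  invFun P := ⨆ X ∈ (P : Set (BGroups S)), X.1.ideal F
  left_inv I := le_antisymm (iSup₂_le fun _ hX => hX)
    (le_of_forall_ideal_le hS fun X hX =>
      le_iSup₂_of_le (f := fun (X : BGroups S) (_ : X ∈ {X : BGroups S | X.1.ideal F ≤ I}) =>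
        X.1.ideal F) X hX le_rfl)
  right_inv P := Subtype.ext (Set.ext fun X => ideal_le_iSup_iff F P X)
  map_rel_iff' := ⟨fun h => le_of_forall_ideal_le hS fun _ hX => h hX, fun h _ hX => hX.trans h⟩

end GrpOver

/-- A complete lattice with an isomorphism to a complete lattice of sets is completely
distributive. -/
theorem iInf_iSup_eq_of_orderIso {α β : Type*} [CompleteLattice α] (L : CompleteSublattice (Set β))
    (e : α ≃o L) {ι : Type*} {κ : ι → Type*} (f : ∀ i, κ i → α) :
    (⨅ i, ⨆ j, f i j) = ⨆ g : ∀ i, κ i, ⨅ i, f i (g i) := by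
  refine e.injective (Subtype.ext (Set.ext fun x => ?_))
  simp only [OrderIso.map_iInf, OrderIso.map_iSup, CompleteSublattice.coe_iInf,
    CompleteSublattice.coe_iSup, Set.mem_iInter, Set.mem_iUnion, Set.iInf_eq_iInter,
    Set.iSup_eq_iUnion]
  exact Classical.skolem

/-- Checked point by point in the lattice of sets: if every `i` had a `j` for which the point is
missed, choosing these would give a function `g` contradicting membership in the right side. -/
theorem iSup_iInf_eq_of_orderIso {α β : Type*} [CompleteLattice α] (L : CompleteSublattice (Set β))
    (e : α ≃o L) {ι : Type*} {κ : ι → Type*} (f : ∀ i, κ i → α) :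
    (⨆ i, ⨅ j, f i j) = ⨅ g : ∀ i, κ i, ⨆ i, f i (g i) := by
  refine e.injective (Subtype.ext (Set.ext fun x => ?_))
  simp only [OrderIso.map_iInf, OrderIso.map_iSup, CompleteSublattice.coe_iInf,
    CompleteSublattice.coe_iSup, Set.mem_iInter, Set.mem_iUnion, Set.iInf_eq_iInter,
    Set.iSup_eq_iUnion]
  refine ⟨fun ⟨i, hi⟩ g => ⟨i, hi (g i)⟩, fun h => ?_⟩
  by_contra! hne
  choose g hg using hne
  obtain ⟨i, hi⟩ := h g
  exact hg i hi

end RelativeBGroups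

theorem mainTheorem1 (F : Type v) [Field F] [CharZero F]
    (K : Type u) [Group K] [Finite K]
    (S : Set (GrpOver K)) (hS : GrpOver.IsRepresentativeSet S) :
    (∃ Φ : GreenIdeal F K ≃o GrpOver.closedSubsets S,
      (∀ I : GreenIdeal F K,
        (Φ I : Set (GrpOver.BGroups S)) = {X | X.1.ideal F ≤ I}) ∧
      (∀ P : GrpOver.closedSubsets S,
        Φ.symm P = ⨆ X ∈ (P : Set (GrpOver.BGroups S)), X.1.ideal F)) ∧
    (∀ (ι : Type w₁) (κ : ι → Type w₂) (f : ∀ i, κ i → GreenIdeal F K),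
      (⨅ i, ⨆ j, f i j) = ⨆ g : ∀ i, κ i, ⨅ i, f i (g i)) ∧
    (∀ (ι : Type w₁) (κ : ι → Type w₂) (f : ∀ i, κ i → GreenIdeal F K),
      (⨆ i, ⨅ j, f i j) = ⨅ g : ∀ i, κ i, ⨆ i, f i (g i)) := by
  refine ⟨⟨GrpOver.idealOrderIso F hS, fun _ => rfl, fun _ => rfl⟩,
    fun ι κ f => ?_, fun ι κ f => ?_⟩
  · exact iInf_iSup_eq_of_orderIso _ (GrpOver.idealOrderIso F hS) f
  · exact iSup_iInf_eq_of_orderIso _ (GrpOver.idealOrderIso F hS) f
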